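/- Conventions. Fix one class of QPT adversaries: either uniform QPT algorithms, or QPT algorithms with polynomial-size quantum advice (the statement holds for each of the two). Adversaries receive $1^\lambda$ and one string and run in time polynomial in $\lambda$ and the length of that string; $\bot$ denotes a symbol outside $\{0,1\}^*$ (given to adversaries encoded as the empty string). $\mathsf{negl}$ denotes a negligible function of $\lambda$. Let $\epsilon,\mu,\nu:\mathbb N\to\mathbb R$ and $\ell:\mathbb N\to\mathbb N$. A *weak $\epsilon$-pseudorandom $(\mu,\nu,\ell)$-PD-PRG* is a family $G=\{G_\lambda\}$ computed by a uniform QPT algorithm, mapping a key $k\in\{0,1\}^\lambda$ to a random output in $\{0,1\}^{\ell(\lambda)}$, such that: (1) there are sets $\mathcal K_\lambda\subseteq\{0,1\}^\lambda$ with $\Pr_{k\leftarrow\{0,1\}^\lambda}[k\in\mathcal K_\lambda]\ge 1-\mu(\lambda)$ such that for every $\lambda$ and $k\in\mathcal K_\lambda$ there is a $y\in\{0,1\}^{\ell(\lambda)}$ with $\Pr[G_\lambda(k)=y]\ge 1-\nu(\lambda)$; (2) $\ell(\lambda)>\lambda$ for all $\lambda$; (3) (weak $\epsilon$-pseudorandomness)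 for every QPT adversary $\mathcal A$ and all sufficiently large $\lambda$, $$\Bigl|\Pr_{k\leftarrow\{0,1\}^\lambda}[\mathcal A(1^\lambda,G_\lambda(k))=1]-\Pr_{y\leftarrow\{0,1\}^{\ell(\lambda)}}[\mathcal A(1^\lambda,y)=1]\Bigr|\le\epsilon(\lambda).$$ A *$(\mu,\ell)$-$\bot$-PRG with weak pseudorandomness $\epsilon$* is a family $G$ computed by a uniform QPT algorithm, mapping $k\in\{0,1\}^\lambda$ to a random output in $\{0,1\}^{\ell(\lambda)}\cup\{\bot\}$, that satisfies (2), (3) and: (1') there are sets $\mathcal K_\lambda\subseteq\{0,1\}^\lambda$ with $\Pr_{k\leftarrow\{0,1\}^\lambda}[k\in\mathcal K_\lambda]\ge 1-\mu(\lambda)$ such that for every $\lambda$ and $k\in\mathcal K_\lambda$ there is a $y\in\{0,1\}^{\ell(\lambda)}$ with $\Pr[G_\lambda(k)=y]\ge 1-\mathsf{negl}(\lambda)$; and for every $\lambda$ and every $k\in\{0,1\}^\lambda$ there is a $y\in\{0,1\}^{\ell(\lambda)}$ with $\Pr[G_\lambda(k)\in\{y,\bot\}]\ge 1-\mathsf{negl}(\lambda)$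 (the negligible functions do not depend on $k$). Proposition. Let $G$ be a weak $\epsilon$-pseudorandom $(\mu,\nu,\ell)$-PD-PRG, where $\nu\ge 0$ and $\nu(\lambda)\le 1/10$ for all sufficiently large $\lambda$. Define $G^{\mathsf{vote}}_\lambda(k)$ as follows: run $G_\lambda(k)$ independently $\lambda$ times, obtaining $y_1,\dots,y_\lambda$; output $y$ if at least $60\%$ of the $y_i$ are equal to $y$, and output $\bot$ if there is no such $y$ (or if $\lambda=0$). Then there is a negligible function $\eta$, not depending on the adversary, such that $G^{\mathsf{vote}}$ is a $(\mu,\ell)$-$\bot$-PRG with weak pseudorandomness $\epsilon(\lambda)+\mu(\lambda)+\nu(\lambda)+\eta(\lambda)$. -/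

import Mathlib

open Filter

noncomputable section

namespace BotPRG

/-! ## Quantum polynomial-time computation

The machine model is a classically controlled quantum machine (a quantum while-language): a fixed
program manipulates finitely many classical variables holding bit strings, and a quantum register
on which it may apply Clifford+T gates, measure, and re-initialise. Qubits are addressed by the
length of a variable. Each transition is one step; a step lengthens a variable that it writes by at
most one bit beyond the current maximal length, and acts on at most two qubits (or discards
the register and starts afresh), so polynomially
many steps are the same as polynomial time of a Turing machine (respectively, polynomial size of a
uniformly generated quantum circuit). -/

/-- State vectors on qubits numbered by `ℕ`, all but finitely many in `|0⟩`. The basis vector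
labelled by `S` is the one in which exactly the qubits in `S` are `|1⟩`. -/
abbrev QState : Type := Finset ℕ →₀ ℂ

/-- Basis vector. -/
def ket (S : Finset ℕ) : QState := Finsupp.single S 1

/-- Linear extension of a map given on basis vectors. -/
def linExt (f : Finset ℕ → QState) (ψ : QState) : QState := Finsupp.linearCombination ℂ f ψ

/-- Hadamard gate on qubit `q`. -/
def gateH (q : ℕ) : QState → QState :=
  linExt fun S => ((Real.sqrt 2 : ℝ) : ℂ)⁻¹ •
    (ket (S.erase q) + (if q ∈ S then (-1 : ℂ) else 1) • ket (insert q S))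

/-- The gate `T = diag(1, e^{iπ/4})` on qubit `q`. -/
def gateT (q : ℕ) : QState → QState :=
  linExt fun S => (if q ∈ S then Complex.exp (Complex.I * (Real.pi / 4 : ℝ)) else 1) • ket S

/-- Controlled NOT with control `q` and target `r` (the identity if `q = r`). -/
def gateCNOT (q r : ℕ) : QState → QState :=
  linExt fun S => if q ∈ S ∧ q ≠ r then ket (symmDiff S {r}) else ket S

/-- Squared norm. -/
def normSq (ψ : QState) : NNReal := ∑ S ∈ ψ.support, ‖ψ S‖₊ ^ 2

/-- Projection onto the vectors in which qubit `q` has the value `b`. -/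
def proj (q : ℕ) (b : Bool) (ψ : QState) : QState := ψ.filter fun S => decide (q ∈ S) = b

theorem normSq_proj_le (q : ℕ) (b : Bool) (ψ : QState) : normSq (proj q b ψ) ≤ normSq ψ := by
  unfold normSq proj
  rw [Finsupp.support_filter]
  refine le_trans (le_of_eq (Finset.sum_congr rfl ?_))
    (Finset.sum_le_sum_of_subset (Finset.filter_subset _ _))
  intro S hS
  rw [Finsupp.filter_apply_pos (fun S : Finset ℕ => decide (q ∈ S) = b) ψ
    (Finset.mem_filter.1 hS).2]

theorem measure_prob_le (q : ℕ) (ψ : QState) : normSq (proj q true ψ) / normSq ψ ≤ 1 :=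
  div_le_one_of_le₀ (normSq_proj_le q true ψ) bot_le

/-- Outcome of measuring qubit `q` in the computational basis. The vector after outcome `b` is
`proj q b ψ`; vectors are not renormalised, hence the quotient in the Born rule. -/
def measureOutcome (q : ℕ) (ψ : QState) : PMF Bool :=
  PMF.ofFintype
    (fun b => ((cond b (normSq (proj q true ψ) / normSq ψ)
      (1 - normSq (proj q true ψ) / normSq ψ) : NNReal) : ENNReal))
    (by
      rw [Fintype.sum_bool, ← ENNReal.coe_add]
      simp only [cond_true, cond_false]
      rw [add_tsub_cancel_of_le (measure_prob_le q ψ), ENNReal.coe_one])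

/-- Programs. Variables are numbered by `ℕ`. -/
inductive Cmd : Type
  | skip : Cmd
  | seq (c d : Cmd) : Cmd
  | push (x : ℕ) (b : Bool) : Cmd
  | pop (x : ℕ) : Cmd
  | copy (x y : ℕ) : Cmd
  | ifHead (x : ℕ) (c d : Cmd) : Cmd
  | ifEq (x y : ℕ) (c d : Cmd) : Cmd
  | whileNonempty (x : ℕ) (c : Cmd) : Cmd
  | hadamard (x : ℕ) : Cmd
  | tgate (x : ℕ) : Cmd
  | cnot (x y : ℕ) : Cmd
  | meas (x y : ℕ) : Cmd
  | qinit : Cmd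

/-- A configuration: commands still to be executed, classical store, quantum register. -/
structure Config : Type where
  ctrl : List Cmd
  store : ℕ → List Bool
  qreg : QState

/-- One step of a machine. An empty control list means that the machine has halted. -/
def step : Config → PMF Config
  | ⟨[], σ, ψ⟩ => PMF.pure ⟨[], σ, ψ⟩
  | ⟨.skip :: K, σ, ψ⟩ => PMF.pure ⟨K, σ, ψ⟩
  | ⟨.seq c d :: K, σ, ψ⟩ => PMF.pure ⟨c :: d :: K, σ, ψ⟩
  | ⟨.push x b :: K, σ, ψ⟩ => PMF.pure ⟨K, Function.update σ x (b :: σ x), ψ⟩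
  | ⟨.pop x :: K, σ, ψ⟩ => PMF.pure ⟨K, Function.update σ x (σ x).tail, ψ⟩
  | ⟨.copy x y :: K, σ, ψ⟩ => PMF.pure ⟨K, Function.update σ x (σ y), ψ⟩
  | ⟨.ifHead x c d :: K, σ, ψ⟩ =>
      PMF.pure ⟨(if (σ x).head? = some true then c else d) :: K, σ, ψ⟩
  | ⟨.ifEq x y c d :: K, σ, ψ⟩ => PMF.pure ⟨(if σ x = σ y then c else d) :: K, σ, ψ⟩
  | ⟨.whileNonempty x c :: K, σ, ψ⟩ =>
      PMF.pure ⟨if σ x = [] then K else c :: .whileNonempty x c :: K, σ, ψ⟩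
  | ⟨.hadamard x :: K, σ, ψ⟩ => PMF.pure ⟨K, σ, gateH (σ x).length ψ⟩
  | ⟨.tgate x :: K, σ, ψ⟩ => PMF.pure ⟨K, σ, gateT (σ x).length ψ⟩
  | ⟨.cnot x y :: K, σ, ψ⟩ => PMF.pure ⟨K, σ, gateCNOT (σ x).length (σ y).length ψ⟩
  | ⟨.meas x y :: K, σ, ψ⟩ =>
      (measureOutcome (σ x).length ψ).map fun b =>
        ⟨K, Function.update σ y (b :: σ y), proj (σ x).length b ψ⟩
  | ⟨.qinit :: K, σ, _⟩ => PMF.pure ⟨K, σ, ket ∅⟩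

/-- The distribution of the configuration after `t` steps. -/
def runFor : ℕ → Config → PMF Config
  | 0, c => PMF.pure c
  | t + 1, c => (step c).bind (runFor t)

/-- Start of program `P` on `(1ⁿ, x)` with quantum register `ψ`: variable `0` holds `1ⁿ`,
variable `1` holds `x`, all other variables are empty. -/
def initConfig (P : Cmd) (ψ : QState) (n : ℕ) (x : List Bool) : Config where
  ctrl := [P]
  store := fun i => if i = 0 then List.replicate n true else if i = 1 then x else []
  qreg := ψ

/-- `P`, started on `(1ⁿ, x)` with quantum register `ψ`, halts with certainty within `t` steps, and
the content of the output variable `2` then has the distribution `D`. -/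
def RunsTo (P : Cmd) (ψ : QState) (n : ℕ) (x : List Bool) (t : ℕ) (D : PMF (List Bool)) : Prop :=
  (∀ c ∈ (runFor t (initConfig P ψ n x)).support, c.ctrl = []) ∧
    (runFor t (initConfig P ψ n x)).map (fun c => c.store 2) = D

/-- The input-output behaviour of a randomised algorithm that receives `1ⁿ` and a bit string. -/
abbrev Behaviour : Type := ℕ → List Bool → PMF (List Bool)

/-- The behaviour is that of a (uniform) quantum polynomial-time algorithm. -/
def IsQPT (D : Behaviour) : Prop :=
  ∃ (P : Cmd) (p : Polynomial ℕ), ∀ n x, RunsTo P (ket ∅) n x (p.eval (n + x.length)) (D n x)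

/-- The behaviour is that of a quantum polynomial-time algorithm with quantum advice: for each `n`
its register initially holds a unit vector on polynomially many qubits. -/
def IsQPTWithAdvice (D : Behaviour) : Prop :=
  ∃ (P : Cmd) (p q : Polynomial ℕ) (ρ : ℕ → QState),
    (∀ n, normSq (ρ n) = 1 ∧ ∀ S ∈ (ρ n).support, S ⊆ Finset.range (q.eval n)) ∧
    ∀ n x, RunsTo P (ρ n) n x (p.eval (n + x.length)) (D n x)

/-- The two usual classes of QPT adversaries. -/
inductive AdversaryModel : Type
  | uniform : AdversaryModel
  | quantumAdvice : AdversaryModel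

/-- `A` is a QPT adversary of the given kind. -/
def IsAdversary : AdversaryModel → Behaviour → Prop
  | .uniform, A => IsQPT A
  | .quantumAdvice, A => IsQPTWithAdvice A

/-! ## Generators -/

/-- `{0,1}ⁿ`. -/
abbrev Bits (n : ℕ) : Type := Fin n → Bool

/-- A string as machine input or output. -/
def encBits {n : ℕ} (y : Bits n) : List Bool := List.ofFn y

/-- An element of `{0,1}ⁿ ∪ {⊥}` as machine input or output, `none` being `⊥`. The symbol `⊥` is
written as the empty string; for `n > 0` it differs from all elements of `{0,1}ⁿ`. -/
def encBot {n : ℕ} : Option (Bits n) → List Bool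
  | none => []
  | some y => encBits y

/-- The family `G` of maps from keys `k ∈ {0,1}ⁿ` to distributions is computed by a uniform QPT
algorithm, outputs being written by `enc`. -/
def QPTFamily {Y : ℕ → Type} (enc : ∀ n, Y n → List Bool) (G : ∀ n, Bits n → PMF (Y n)) : Prop :=
  ∃ D : Behaviour, IsQPT D ∧ ∀ n k, D n (encBits k) = (G n k).map (enc n)

/-- The probability that a uniformly random key lies in `K`. -/
def keyProb {n : ℕ} (K : Set (Bits n)) : ℝ :=
  ((PMF.uniformOfFintype (Bits n)).toOuterMeasure K).toReal

/-- `Pr_{k ← {0,1}ⁿ}[y ← G_n(k) : A(1ⁿ, y) = 1]`. -/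
def realProb {Y : ℕ → Type} (enc : ∀ n, Y n → List Bool) (G : ∀ n, Bits n → PMF (Y n))
    (A : Behaviour) (n : ℕ) : ℝ :=
  (((PMF.uniformOfFintype (Bits n)).bind fun k => (G n k).bind fun y => A n (enc n y))
    [true]).toReal

/-- `Pr_{y ← {0,1}^ℓ(n)}[A(1ⁿ, y) = 1]`. -/
def idealProb (ℓ : ℕ → ℕ) (A : Behaviour) (n : ℕ) : ℝ :=
  (((PMF.uniformOfFintype (Bits (ℓ n))).bind fun y => A n (encBits y)) [true]).toReal

/-- Weak `ε`-pseudorandomness: every QPT adversary that sees one output has, for all sufficiently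
large `n`, distinguishing advantage at most `ε n`. -/
def WeakPseudorandom (adv : AdversaryModel) (ε : ℕ → ℝ) (ℓ : ℕ → ℕ) {Y : ℕ → Type}
    (enc : ∀ n, Y n → List Bool) (G : ∀ n, Bits n → PMF (Y n)) : Prop :=
  ∀ A : Behaviour, IsAdversary adv A →
    ∀ᶠ n in atTop, |realProb enc G A n - idealProb ℓ A n| ≤ ε n

/-- A negligible function. -/
def Negligible (η : ℕ → ℝ) : Prop :=
  Asymptotics.SuperpolynomialDecay atTop (fun n : ℕ => (n : ℝ)) η

/-- `G` is a weak `ε`-pseudorandom `(μ, ν, ℓ)`-PD-PRG. -/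
structure IsWeakPDPRG (adv : AdversaryModel) (ε μ ν : ℕ → ℝ) (ℓ : ℕ → ℕ)
    (G : ∀ n, Bits n → PMF (Bits (ℓ n))) : Prop where
  qpt : QPTFamily (fun _ => encBits) G
  pseudodeterminism : ∃ K : ∀ n, Set (Bits n),
    (∀ n, 1 - μ n ≤ keyProb (K n)) ∧
    ∀ n, ∀ k ∈ K n, ∃ y, 1 - ν n ≤ (G n k y).toReal
  stretch : ∀ n, n < ℓ n
  pseudorandom : WeakPseudorandom adv ε ℓ (fun _ => encBits) G

/-- `G` is a `(μ, ℓ)`-⊥-PRG with weak `ε`-pseudorandomness. -/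
structure IsWeakBotPRG (adv : AdversaryModel) (ε μ : ℕ → ℝ) (ℓ : ℕ → ℕ)
    (G : ∀ n, Bits n → PMF (Option (Bits (ℓ n)))) : Prop where
  qpt : QPTFamily (fun _ => encBot) G
  pseudodeterminism : ∃ K : ∀ n, Set (Bits n),
    (∀ n, 1 - μ n ≤ keyProb (K n)) ∧
    (∃ η, Negligible η ∧ ∀ n, ∀ k ∈ K n, ∃ y, 1 - η n ≤ (G n k (some y)).toReal) ∧
    (∃ η, Negligible η ∧ ∀ n k, ∃ y,
      1 - η n ≤ ((G n k).toOuterMeasure {some y, none}).toReal)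
  stretch : ∀ n, n < ℓ n
  pseudorandom : WeakPseudorandom adv ε ℓ (fun _ => encBot) G

/-! ## The voting construction -/

/-- The list of results of `m` independent samples from `p`. -/
def iid {α : Type} (p : PMF α) : ℕ → PMF (List α)
  | 0 => PMF.pure []
  | m + 1 => p.bind fun y => (iid p m).map fun ys => y :: ys

/-- `vote(y₁, …, y_m)` is the (unique) `y` that makes up at least `60%` of the list, and `⊥` if
there is none. -/
def vote {α : Type} [DecidableEq α] (ys : List α) : Option α :=
  ys.find? fun y => decide (60 * ys.length ≤ 100 * ys.count y)

/-- `G^vote_n(k) = vote(y₁, …, y_n)` for `n` independent runs `y₁, …, y_n` of `G_n(k)`. -/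
def Gvote {ℓ : ℕ → ℕ} (G : ∀ n, Bits n → PMF (Bits (ℓ n))) :
    ∀ n, Bits n → PMF (Option (Bits (ℓ n))) :=
  fun n k => (iid (G n k) n).map vote

end BotPRG

end

/-!
The vote is a polynomial-time computation, it nearly always returns the likely output on good keys,
and on every key it can hardly return two different outputs.

*Computability.* A program `P` that computes `G` is turned into `voteMachine P N`, where `N ≥ 3`
bounds the variables of `P` and leaves room for the input and output variables `0`, `1`, `2`. The
new program keeps its own data in variables from `N` on. `n` times it resets the variables below `N`
and the register, restores the input, and runs `P` as a subroutine (`HaltsWith.within`: a program is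
indifferent to the variables that do not occur in it and to what is executed afterwards). The
outputs are stored on one stack in a self-delimiting encoding. The vote is then a deterministic
double loop over the stack, `voteProgram`: for each candidate a counter with `3n` bits loses five of
them per vote, so it ends up empty exactly if the candidate has at least `60%` of the votes. The
result is `IsQPT.vote`, and for generators `QPTFamily.Gvote`.

*Tail bounds.* Let `π` be the probability of a property of a sample, and `π ≤ β`. An exponential
moment bound gives, for a fraction larger than `β`, constants `C` and `ρ < 1` such that the property
holds for at least one and at least this fraction of `m` samples with probability at most
`π C ρ ^ m` (`toOuterMeasure_tail_le`). If one output has probability at least `9/10`, then the others fill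
more than `40%` of the samples with exponentially small probability, so the vote returns the likely
output (`one_sub_voteError_le_of_likely`). For an arbitrary key, all outputs but the most likely one
have probability at most `1/2`, and the probability that one of these gets `60%` of the votes is
bounded by the sum of the individual bounds. There may be exponentially many outputs, but the factor
`π` makes the sum at most `C ρ ^ m` (`exists_one_sub_voteError_le`).

*Pseudorandomness.* On a good key the generator and the vote take the same value except with
probability `ν` and `η` respectively, and keys are bad with probability at most `μ`. Hence the two
output distributions differ by at most `μ + ν + η` for any adversary (`abs_realProb_sub_le`), and
the triangle inequality does the rest.
-/

namespace BotPRG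

/-! ### Running machines -/

/-- Started in the configuration `c`, the machine halts with certainty within `t` steps, and the
output variable `2` then has the distribution `D`. -/
def HaltsWith (c : Config) (t : ℕ) (D : PMF (List Bool)) : Prop :=
  (∀ c' ∈ (runFor t c).support, c'.ctrl = []) ∧ (runFor t c).map (fun c' => c'.store 2) = D

theorem pmf_bind_congr {α β : Type*} {p : PMF α} {f g : α → PMF β}
    (h : ∀ a ∈ p.support, f a = g a) : p.bind f = p.bind g := by
  ext b
  simp only [PMF.bind_apply]
  refine tsum_congr fun a => ?_
  by_cases ha : p a = 0
  · simp [ha]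
  · rw [h a ((PMF.mem_support_iff _ _).2 ha)]

theorem runFor_add (s t : ℕ) (c : Config) : runFor (s + t) c = (runFor s c).bind (runFor t) := by
  induction s generalizing c with
  | zero => simp [runFor, PMF.pure_bind]
  | succ s ih =>
    rw [Nat.succ_add, runFor, runFor, PMF.bind_bind]
    exact congrArg _ (funext ih)

theorem runFor_of_ctrl_nil (t : ℕ) (σ : ℕ → List Bool) (ψ : QState) :
    runFor t ⟨[], σ, ψ⟩ = PMF.pure ⟨[], σ, ψ⟩ := by
  induction t with
  | zero => rfl
  | succ t ih => rw [runFor, step, PMF.pure_bind, ih]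

theorem haltsWith_nil (t : ℕ) (σ : ℕ → List Bool) (ψ : QState) :
    HaltsWith ⟨[], σ, ψ⟩ t (PMF.pure (σ 2)) := by
  simp [HaltsWith, runFor_of_ctrl_nil, PMF.pure_map]

theorem HaltsWith.of_runFor_eq_pure {c c' : Config} {s t : ℕ} {D : PMF (List Bool)}
    (hs : runFor s c = PMF.pure c') (h : HaltsWith c' t D) : HaltsWith c (s + t) D := by
  unfold HaltsWith at *
  rwa [runFor_add, hs, PMF.pure_bind]

theorem HaltsWith.mono {c : Config} {s t : ℕ} {D : PMF (List Bool)} (h : HaltsWith c s D)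
    (hst : s ≤ t) : HaltsWith c t D := by
  obtain ⟨u, rfl⟩ := Nat.exists_eq_add_of_le hst
  have : runFor (s + u) c = runFor s c := by
    rw [runFor_add]
    refine (pmf_bind_congr fun c' hc' => ?_).trans (PMF.bind_pure _)
    obtain ⟨K, σ, ψ⟩ := c'
    obtain rfl : K = [] := h.1 _ hc'
    exact runFor_of_ctrl_nil u σ ψ
  unfold HaltsWith at *
  rwa [this]

/-! ### Programs as subroutines -/

/-- A strict upper bound for the variables that occur in a program. -/
def Cmd.varBound : Cmd → ℕ
  | .skip => 0
  | .seq c d => max c.varBound d.varBound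
  | .push x _ => x + 1
  | .pop x => x + 1
  | .copy x y => max (x + 1) (y + 1)
  | .ifHead x c d => max (x + 1) (max c.varBound d.varBound)
  | .ifEq x y c d => max (max (x + 1) (y + 1)) (max c.varBound d.varBound)
  | .whileNonempty x c => max (x + 1) c.varBound
  | .hadamard x => x + 1
  | .tgate x => x + 1
  | .cnot x y => max (x + 1) (y + 1)
  | .meas x y => max (x + 1) (y + 1)
  | .qinit => 0

/-- The store that agrees with `σ` on the variables below `N` and with `τ` on the others. -/
def merge (N : ℕ) (σ τ : ℕ → List Bool) : ℕ → List Bool := fun i => if i < N then σ i else τ i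

theorem merge_of_lt {N i : ℕ} (σ τ : ℕ → List Bool) (h : i < N) : merge N σ τ i = σ i := if_pos h

theorem merge_of_le {N i : ℕ} (σ τ : ℕ → List Bool) (h : N ≤ i) : merge N σ τ i = τ i :=
  if_neg h.not_gt

theorem update_merge {N x : ℕ} (hx : x < N) (σ τ : ℕ → List Bool) (v : List Bool) :
    Function.update (merge N σ τ) x v = merge N (Function.update σ x v) τ := by
  funext i
  by_cases hi : i = x
  · subst hi; simp [merge, hx]
  · simp [merge, hi]

/-- A configuration of a subroutine with variables below `N`, seen as a configuration of a caller
that continues with `K` and whose own variables have the values `τ`. -/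
def Config.within (N : ℕ) (K : List Cmd) (τ : ℕ → List Bool) (c : Config) : Config :=
  ⟨c.ctrl ++ K, merge N c.store τ, c.qreg⟩

theorem step_within {N : ℕ} (c : Cmd) (L K : List Cmd) (σ τ : ℕ → List Bool) (ψ : QState)
    (hc : c.varBound ≤ N) :
    step (Config.within N K τ ⟨c :: L, σ, ψ⟩) =
      (step ⟨c :: L, σ, ψ⟩).map (Config.within N K τ) := by
  cases c <;> simp only [Cmd.varBound, max_le_iff, Nat.succ_le_iff] at hc <;>
    simp only [Config.within, List.cons_append, step, PMF.pure_map, PMF.map_comp] <;>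
    simp only [merge_of_lt, update_merge, hc] <;> first | rfl | skip
  split_ifs <;> rfl

theorem varBound_of_mem_step {N : ℕ} {c : Cmd} {L : List Cmd} {σ : ℕ → List Bool} {ψ : QState}
    (hL : ∀ d ∈ c :: L, d.varBound ≤ N) :
    ∀ c' ∈ (step ⟨c :: L, σ, ψ⟩).support, ∀ d ∈ c'.ctrl, d.varBound ≤ N := by
  intro c' hc'
  rw [List.forall_mem_cons] at hL
  obtain ⟨hc, hL⟩ := hL
  cases c <;> simp only [step, PMF.support_pure, PMF.support_map, Set.mem_singleton_iff,
      Set.mem_image] at hc' <;>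
    (first | subst hc' | (obtain ⟨b, -, hc'⟩ := hc'; subst hc')) <;> try exact hL
  all_goals simp only [Cmd.varBound, max_le_iff] at hc
  all_goals try split_ifs
  all_goals simp only [List.forall_mem_cons, Cmd.varBound, max_le_iff]
  all_goals tauto

/-- A subroutine that halts with certainty can be followed by any continuation `K`, and leaves the
variables that do not occur in it alone. -/
theorem HaltsWith.within {N T : ℕ} {K : List Cmd} {τ : ℕ → List Bool}
    {F : List Bool → PMF (List Bool)} (t : ℕ) (c : Config)
    (hL : ∀ d ∈ c.ctrl, d.varBound ≤ N)
    (h : ∀ c' ∈ (runFor t c).support, c'.ctrl = [])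
    (hK : ∀ c' ∈ (runFor t c).support,
      HaltsWith ⟨K, merge N c'.store τ, c'.qreg⟩ T (F (c'.store 2))) :
    HaltsWith (c.within N K τ) (t + T) ((runFor t c).bind fun c' => F (c'.store 2)) := by
  induction t generalizing c with
  | zero =>
    obtain ⟨L, σ, ψ⟩ := c
    obtain rfl : L = [] := h ⟨L, σ, ψ⟩ (by simp [runFor])
    have := hK ⟨[], σ, ψ⟩ (by simp [runFor])
    simpa [runFor, Config.within, PMF.pure_bind] using this
  | succ t ih =>
    obtain ⟨L, σ, ψ⟩ := c
    cases L with
    | nil =>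
      rw [runFor_of_ctrl_nil] at hK ⊢
      have := hK ⟨[], σ, ψ⟩ (by simp)
      rw [PMF.pure_bind]
      exact HaltsWith.mono (by simpa [Config.within] using this) (Nat.le_add_left _ _)
    | cons d L =>
      have key : ∀ c' ∈ (BotPRG.step ⟨d :: L, σ, ψ⟩).support,
          HaltsWith (c'.within N K τ) (t + T) ((runFor t c').bind fun c' => F (c'.store 2)) := by
        intro c' hc'
        have hsub : ∀ c'' ∈ (runFor t c').support,
            c'' ∈ (runFor (t + 1) ⟨d :: L, σ, ψ⟩).support := fun c'' hc'' => by
          rw [runFor, PMF.mem_support_bind_iff]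
          exact ⟨c', hc', hc''⟩
        exact ih c' (varBound_of_mem_step hL c' hc') (fun c'' hc'' => h c'' (hsub c'' hc''))
          (fun c'' hc'' => hK c'' (hsub c'' hc''))
      have hstep := step_within d L K σ τ ψ (hL d (by simp))
      refine ⟨fun c'' hc'' => ?_, ?_⟩
      · rw [show t + 1 + T = (t + T) + 1 by ring, runFor, hstep, PMF.bind_map,
          PMF.mem_support_bind_iff] at hc''
        obtain ⟨c', hc', hc''⟩ := hc''
        exact (key c' hc').1 c'' hc''
      · rw [show t + 1 + T = (t + T) + 1 by ring, runFor, hstep, PMF.bind_map, PMF.map_bind,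
          runFor, PMF.bind_bind]
        exact pmf_bind_congr fun c' hc' => (key c' hc').2

theorem length_store_step {M : ℕ} {c : Config} (h : ∀ i, (c.store i).length ≤ M) :
    ∀ c' ∈ (step c).support, ∀ i, (c'.store i).length ≤ M + 1 := by
  intro c' hc' i
  obtain ⟨L, σ, ψ⟩ := c
  have h' : ∀ i, (σ i).length ≤ M := h
  rcases L with _ | ⟨d, L⟩
  · simp only [step, PMF.support_pure, Set.mem_singleton_iff] at hc'
    subst hc'
    exact (h i).trans (Nat.le_succ _)
  · cases d <;> simp only [step, PMF.support_pure, PMF.support_map, Set.mem_singleton_iff,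
        Set.mem_image] at hc' <;>
      (first | subst hc' | (obtain ⟨b, -, hc'⟩ := hc'; subst hc')) <;>
      simp only [Function.update_apply] <;>
      (try split_ifs) <;> (try simp only [List.length_cons, List.length_tail]) <;>
      first
        | exact (h' _).trans (Nat.le_succ _)
        | exact Nat.succ_le_succ (h' _)
        | exact (Nat.sub_le _ _).trans ((h' _).trans (Nat.le_succ _))

/-- A machine writes at most one bit per step. -/
theorem length_store_runFor {M : ℕ} (t : ℕ) {c : Config} (h : ∀ i, (c.store i).length ≤ M) :
    ∀ c' ∈ (runFor t c).support, ∀ i, (c'.store i).length ≤ M + t := by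
  induction t generalizing c M with
  | zero =>
    intro c' hc'
    simp only [runFor, PMF.support_pure, Set.mem_singleton_iff] at hc'
    subst hc'
    exact h
  | succ t ih =>
    intro c' hc' i
    rw [runFor, PMF.mem_support_bind_iff] at hc'
    obtain ⟨c₁, h₁, h₂⟩ := hc'
    have := ih (length_store_step h c₁ h₁) c' h₂ i
    omega

theorem length_le_of_runsTo {P : Cmd} {ψ : QState} {n t : ℕ} {x : List Bool}
    {D : PMF (List Bool)} (h : RunsTo P ψ n x t D) :
    ∀ y ∈ D.support, y.length ≤ n + x.length + t := by
  intro y hy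
  rw [← h.2, PMF.support_map] at hy
  obtain ⟨c, hc, rfl⟩ := hy
  refine length_store_runFor t (fun i => ?_) c hc 2
  simp only [initConfig]
  split_ifs <;> simp

/-! ### Deterministic programs -/

/-- From the store `σ` the program `c` deterministically takes at most `t` steps, ends with the
store `σ'`, and leaves the quantum register alone. -/
def Det (c : Cmd) (σ : ℕ → List Bool) (t : ℕ) (σ' : ℕ → List Bool) : Prop :=
  ∃ s ≤ t, ∀ K ψ, runFor s ⟨c :: K, σ, ψ⟩ = PMF.pure ⟨K, σ', ψ⟩

theorem Det.haltsWith {c : Cmd} {σ σ' : ℕ → List Bool} {t T : ℕ} {K : List Cmd} {ψ : QState}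
    {D : PMF (List Bool)} (h : Det c σ t σ') (hK : HaltsWith ⟨K, σ', ψ⟩ T D) :
    HaltsWith ⟨c :: K, σ, ψ⟩ (t + T) D := by
  obtain ⟨s, hs, h⟩ := h
  exact (HaltsWith.of_runFor_eq_pure (h K ψ) hK).mono (by omega)

theorem Det.mono {c : Cmd} {σ σ' : ℕ → List Bool} {t t' : ℕ} (h : Det c σ t σ') (htt : t ≤ t') :
    Det c σ t' σ' := by
  obtain ⟨s, hs, h⟩ := h
  exact ⟨s, hs.trans htt, h⟩

theorem Det.of_step {c : Cmd} {σ σ' : ℕ → List Bool}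
    (h : ∀ K ψ, step ⟨c :: K, σ, ψ⟩ = PMF.pure ⟨K, σ', ψ⟩) : Det c σ 1 σ' :=
  ⟨1, le_rfl, fun K ψ => by rw [runFor, h, PMF.pure_bind]; rfl⟩

theorem Det.of_step_cons {c d : Cmd} {σ σ' : ℕ → List Bool} {t : ℕ}
    (h : ∀ K ψ, step ⟨c :: K, σ, ψ⟩ = PMF.pure ⟨d :: K, σ, ψ⟩) (hd : Det d σ t σ') :
    Det c σ (t + 1) σ' := by
  obtain ⟨s, hs, hd⟩ := hd
  exact ⟨s + 1, by omega, fun K ψ => by rw [runFor, h, PMF.pure_bind, hd]⟩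

theorem Det.of_step_cons₂ {c d e : Cmd} {σ σ' σ'' : ℕ → List Bool} {t u : ℕ}
    (h : ∀ K ψ, step ⟨c :: K, σ, ψ⟩ = PMF.pure ⟨d :: e :: K, σ, ψ⟩) (hd : Det d σ t σ')
    (he : Det e σ' u σ'') : Det c σ (t + u + 1) σ'' := by
  obtain ⟨s, hs, hd⟩ := hd
  obtain ⟨r, hr, he⟩ := he
  exact ⟨(s + r) + 1, by omega, fun K ψ => by
    rw [runFor, h, PMF.pure_bind, runFor_add, hd, PMF.pure_bind, he]⟩

theorem det_skip (σ : ℕ → List Bool) : Det .skip σ 1 σ := .of_step fun _ _ => rfl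

theorem det_push (x : ℕ) (b : Bool) (σ : ℕ → List Bool) :
    Det (.push x b) σ 1 (Function.update σ x (b :: σ x)) := .of_step fun _ _ => rfl

theorem det_pop (x : ℕ) (σ : ℕ → List Bool) :
    Det (.pop x) σ 1 (Function.update σ x (σ x).tail) := .of_step fun _ _ => rfl

theorem det_copy (x y : ℕ) (σ : ℕ → List Bool) :
    Det (.copy x y) σ 1 (Function.update σ x (σ y)) := .of_step fun _ _ => rfl

theorem Det.seq {c d : Cmd} {σ σ' σ'' : ℕ → List Bool} {t u : ℕ} (hc : Det c σ t σ')
    (hd : Det d σ' u σ'') : Det (.seq c d) σ (t + u + 1) σ'' :=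
  .of_step_cons₂ (fun _ _ => rfl) hc hd

theorem Det.ifHead_true {x : ℕ} {c d : Cmd} {σ σ' : ℕ → List Bool} {t : ℕ}
    (hx : (σ x).head? = some true) (hc : Det c σ t σ') : Det (.ifHead x c d) σ (t + 1) σ' :=
  .of_step_cons (fun _ _ => by simp [step, hx]) hc

theorem Det.ifHead_false {x : ℕ} {c d : Cmd} {σ σ' : ℕ → List Bool} {t : ℕ}
    (hx : (σ x).head? ≠ some true) (hd : Det d σ t σ') : Det (.ifHead x c d) σ (t + 1) σ' :=
  .of_step_cons (fun _ _ => by simp [step, hx]) hd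

theorem Det.ifEq_pos {x y : ℕ} {c d : Cmd} {σ σ' : ℕ → List Bool} {t : ℕ}
    (h : σ x = σ y) (hc : Det c σ t σ') : Det (.ifEq x y c d) σ (t + 1) σ' :=
  .of_step_cons (fun _ _ => by simp [step, h]) hc

theorem Det.ifEq_neg {x y : ℕ} {c d : Cmd} {σ σ' : ℕ → List Bool} {t : ℕ}
    (h : σ x ≠ σ y) (hd : Det d σ t σ') : Det (.ifEq x y c d) σ (t + 1) σ' :=
  .of_step_cons (fun _ _ => by simp [step, h]) hd

theorem det_while_nil {x : ℕ} {c : Cmd} {σ : ℕ → List Bool} (hx : σ x = []) :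
    Det (.whileNonempty x c) σ 1 σ := .of_step fun _ _ => by simp [step, hx]

theorem Det.while_cons {x : ℕ} {c : Cmd} {σ σ' σ'' : ℕ → List Bool} {t u : ℕ} (hx : σ x ≠ [])
    (hc : Det c σ t σ') (hw : Det (.whileNonempty x c) σ' u σ'') :
    Det (.whileNonempty x c) σ (t + u + 1) σ'' :=
  .of_step_cons₂ (fun _ _ => by simp [step, hx]) hc hw

/-! ### Lists of strings in a variable -/

/-- Self-delimiting encoding of a string: the bits in reverse order, each after the marker `1`,
followed by the marker `0`. The reversal makes writing the encoding on a stack, and reading it back,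
a matter of moving one bit at a time. -/
def encodeItem (y : List Bool) : List Bool := y.reverse.flatMap (fun b => [true, b]) ++ [false]

/-- Encoding of a list of strings as one string. -/
def encodeItems (l : List (List Bool)) : List Bool := l.flatMap encodeItem

theorem encodeItems_cons (y : List Bool) (l : List (List Bool)) :
    encodeItems (y :: l) = encodeItem y ++ encodeItems l := rfl

/-- Moves the bits of the variable `y`, with markers, to the stack `s`. -/
def pushBits (y s : ℕ) : Cmd :=
  .whileNonempty y (.seq (.ifHead y (.push s true) (.push s false)) (.seq (.push s true) (.pop y)))

/-- Moves the string in the variable `y` to the list of strings `s`. -/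
def pushItem (y s : ℕ) : Cmd := .seq (.push s false) (pushBits y s)

theorem det_pushBits {y s : ℕ} (hys : y ≠ s) (w : List Bool) (σ : ℕ → List Bool) (hw : σ y = w) :
    Det (pushBits y s) σ (7 * w.length + 1)
      (Function.update (Function.update σ y []) s
        (w.reverse.flatMap (fun b => [true, b]) ++ σ s)) := by
  induction w generalizing σ with
  | nil =>
    have h : Function.update (Function.update σ y []) s (σ s) = σ := by
      rw [← hw, Function.update_eq_self, Function.update_eq_self]
    simpa [h, pushBits] using det_while_nil hw
  | cons b w ih =>
    have h₁ : Det (.ifHead y (.push s true) (.push s false)) σ 2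
        (Function.update σ s (b :: σ s)) := by
      cases b
      · exact Det.ifHead_false (by simp [hw]) (det_push s false σ)
      · exact Det.ifHead_true (by simp [hw]) (det_push s true σ)
    have h₂ := h₁.seq ((det_push s true _).seq (det_pop y _))
    have h₃ := Det.while_cons (by simp [hw]) h₂ (ih _ (by simp [hys, hw]))
    have h₄ : Det (pushBits y s) _ (7 * (b :: w).length + 1) _ :=
      h₃.mono (by simp only [List.length_cons]; omega)
    convert h₄ using 1
    funext i
    by_cases his : i = s
    · subst his; simp [hys.symm]
    · by_cases hiy : i = y <;> simp [his, hiy, hys]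

theorem det_pushItem {y s : ℕ} (hys : y ≠ s) (σ : ℕ → List Bool) :
    Det (pushItem y s) σ (7 * (σ y).length + 3)
      (Function.update (Function.update σ y []) s (encodeItem (σ y) ++ σ s)) := by
  have h := (det_push s false σ).seq (det_pushBits hys (σ y) _ (by simp [hys]))
  have h' : Det (pushItem y s) _ (7 * (σ y).length + 3) _ := h.mono (by omega)
  convert h' using 1
  funext i
  by_cases his : i = s
  · subst his; simp [encodeItem]
  · by_cases hiy : i = y <;> simp [his, hiy, hys]

/-- Takes the items off the list of strings `s`, one after the other, and executes `body` with the
current item in the variable `y`. The variable `e` is assumed to be empty. -/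
def forEach (s y e : ℕ) (body : Cmd) : Cmd :=
  .whileNonempty s (.ifHead s
    (.seq (.pop s) (.seq (.ifHead s (.push y true) (.push y false)) (.pop s)))
    (.seq (.pop s) (.seq body (.copy y e))))

theorem det_forEach_bits {s y e : ℕ} {body : Cmd} (hsy : s ≠ y) (rest : List Bool) {t : ℕ}
    {σ' : ℕ → List Bool} (r : List Bool) (σ : ℕ → List Bool)
    (hs : σ s = r.flatMap (fun b => [true, b]) ++ false :: rest)
    (h : Det (forEach s y e body)
      (Function.update (Function.update σ s (false :: rest)) y (r.reverse ++ σ y)) t σ') :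
    Det (forEach s y e body) σ (9 * r.length + t) σ' := by
  induction r generalizing σ with
  | nil =>
    simp only [List.flatMap_nil, List.nil_append, List.reverse_nil] at hs h
    rw [← hs, Function.update_eq_self, Function.update_eq_self] at h
    simpa using h
  | cons b r ih =>
    set σ₁ := Function.update σ s (σ s).tail with hσ₁
    have h₁ : Det (.ifHead s (.push y true) (.push y false)) σ₁ 2
        (Function.update σ₁ y (b :: σ y)) := by
      have hy : σ₁ y = σ y := by simp [hσ₁, hsy.symm]
      rw [← hy]
      cases b
      · exact Det.ifHead_false (by simp [hσ₁, hs]) (det_push y false σ₁)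
      · exact Det.ifHead_true (by simp [hσ₁, hs]) (det_push y true σ₁)
    have h₂ := ((det_pop s σ).seq (h₁.seq (det_pop s _)))
    have h₃ := Det.while_cons (u := 9 * r.length + t) (σ'' := σ') (by simp [hs])
      (Det.ifHead_true (x := s) (by simp [hs]) h₂) (ih _ (by simp [hσ₁, hsy, hs]) ?_)
    · exact h₃.mono (by simp only [List.length_cons]; omega)
    · convert h using 1
      funext i
      by_cases hiy : i = y
      · subst hiy; simp [hsy.symm]
      · by_cases his : i = s <;> simp [hiy, his, hσ₁, hsy]

/-- A loop invariant `I`, which speaks of the items still to come and does not depend on the two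
loop variables, is carried through `forEach`. -/
theorem det_forEach {s y e : ℕ} {body : Cmd} {t M : ℕ} (hsy : s ≠ y)
    (I : List (List Bool) → (ℕ → List Bool) → Prop)
    (hIs : ∀ l σ a, I l σ → I l (Function.update σ s a))
    (hIy : ∀ l σ a, I l σ → I l (Function.update σ y a))
    (hIe : ∀ l σ, I l σ → σ e = [])
    (hbody : ∀ z l σ, I (z :: l) σ → σ y = z → ∃ σ', Det body σ t σ' ∧ I l σ' ∧ σ' s = σ s)
    (l : List (List Bool)) (σ : ℕ → List Bool) (hl : ∀ z ∈ l, z.length ≤ M) (hI : I l σ)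
    (hs : σ s = encodeItems l) (hy : σ y = []) :
    ∃ σ', Det (forEach s y e body) σ (l.length * (9 * M + t + 6) + 1) σ' ∧ I [] σ' ∧
      σ' y = [] := by
  induction l generalizing σ with
  | nil => exact ⟨σ, by simpa [forEach] using det_while_nil hs, hI, hy⟩
  | cons z l ih =>
    set σ₁ := Function.update (Function.update σ s (false :: encodeItems l)) y z with hσ₁
    set σ₂ := Function.update σ₁ s (encodeItems l) with hσ₂
    obtain ⟨σ₃, hdet, hI₃, hs₃⟩ := hbody z l σ₂ (hIs _ _ _ (hIy _ _ _ (hIs _ _ _ hI)))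
      (by simp [hσ₂, hσ₁, hsy.symm])
    set σ₄ := Function.update σ₃ y [] with hσ₄
    obtain ⟨σ', hσ', hI', hy'⟩ := ih σ₄ (fun z' hz' => hl z' (List.mem_cons_of_mem _ hz'))
      (hIy _ _ _ hI₃) (by simp [hσ₄, hsy, hs₃, hσ₂]) (by simp [hσ₄])
    refine ⟨σ', ?_, hI', hy'⟩
    have hcopy : Det (.copy y e) σ₃ 1 σ₄ := by
      have := det_copy y e σ₃
      rwa [hIe l σ₃ hI₃] at this
    have hpop : Det (.pop s) σ₁ 1 σ₂ := by
      have := det_pop s σ₁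
      simpa [hσ₂, hσ₁, hsy] using this
    have hiter := Det.while_cons (x := s) (by simp [hσ₁, hsy])
      (Det.ifHead_false (x := s) (c := (.seq (.pop s)
        (.seq (.ifHead s (.push y true) (.push y false)) (.pop s)))) (by simp [hσ₁, hsy])
        (hpop.seq (hdet.seq hcopy))) hσ'
    have := det_forEach_bits hsy (encodeItems l) z.reverse σ
      (by rw [hs, encodeItems_cons, encodeItem]; simp) (σ' := σ')
      (t := 1 + (t + 1 + 1) + 1 + 1 + (l.length * (9 * M + t + 6) + 1) + 1)
      (by rw [hy]; simpa [← hσ₁, forEach] using hiter)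
    refine this.mono ?_
    have hz := hl z (by simp)
    simp only [List.length_reverse, List.length_cons, Nat.add_mul]
    omega

/-! ### The voting program -/

/-- The last string of the list that makes up at least `60%` of it, and the empty string if there is
none. -/
def voteLast (l : List (List Bool)) : List Bool :=
  l.foldl (fun acc y => if 3 * l.length ≤ 5 * l.count y then y else acc) []

theorem voteLast_reverse (ys : List (List Bool)) : voteLast ys.reverse = (vote ys).getD [] := by
  have h : ∀ (q : List Bool → Prop) [DecidablePred q] (l : List (List Bool)),
      l.foldr (fun y acc => if q y then y else acc) [] =
        (l.find? fun y => decide (q y)).getD [] := by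
    intro q _ l
    induction l with
    | nil => rfl
    | cons y l ih => by_cases hy : q y <;> simp [hy, ih]
  rw [voteLast, List.foldl_reverse]
  simp only [List.length_reverse, List.count_reverse]
  rw [h, vote]
  congr 3
  funext y
  rw [lawful_beq_subsingleton (α := List Bool) instBEqOfDecidableEq List.instBEq]
  exact decide_eq_decide.2 (by omega)

/-! The variables of the voting program, for a subroutine with variables below `N`:
`N` (always empty), `N + 1` and `N + 2` (the input), `N + 3` (number of runs still to be made),
`N + 4` (outputs of the runs), `N + 5` (three bits for each run), `N + 6`, `N + 7` (loop over the
candidates), `N + 8`, `N + 9` (loop over the votes), `N + 10` (three bits for each run, less five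
bits for each vote for the candidate), `N + 11` (result). -/

/-- Takes five bits off the variable `N + 10` for each vote for the candidate. -/
def countVotes (N : ℕ) : Cmd :=
  forEach (N + 8) (N + 9) N (.ifEq (N + 9) (N + 7) (.seq (.pop (N + 10)) (.seq (.pop (N + 10))
    (.seq (.pop (N + 10)) (.seq (.pop (N + 10)) (.pop (N + 10)))))) .skip)

theorem det_countVotes {N M : ℕ} {l : List (List Bool)} {σ : ℕ → List Bool}
    (hl : ∀ z ∈ l, z.length ≤ M) (he : σ N = []) (hs : σ (N + 8) = encodeItems l)
    (hy : σ (N + 9) = []) :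
    ∃ σ', Det (countVotes N) σ (l.length * (9 * M + 16) + 1) σ' ∧
      (∀ i, i ≠ N + 8 → i ≠ N + 9 → i ≠ N + 10 → σ' i = σ i) ∧ σ' (N + 9) = [] ∧
      (σ' (N + 10)).length = (σ (N + 10)).length - 5 * l.count (σ (N + 7)) := by
  obtain ⟨σ', hdet, ⟨h₁, h₂⟩, h₃⟩ := det_forEach (s := N + 8) (y := N + 9) (e := N) (t := 10)
    (body := .ifEq (N + 9) (N + 7) (.seq (.pop (N + 10)) (.seq (.pop (N + 10))
      (.seq (.pop (N + 10)) (.seq (.pop (N + 10)) (.pop (N + 10)))))) .skip)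
    (by simp)
    (fun l' σ' => (∀ i, i ≠ N + 8 → i ≠ N + 9 → i ≠ N + 10 → σ' i = σ i) ∧
      (σ' (N + 10)).length - 5 * l'.count (σ (N + 7)) =
        (σ (N + 10)).length - 5 * l.count (σ (N + 7)))
    (fun l' τ a h => ⟨fun i h8 h9 h10 => by
      rw [Function.update_of_ne h8]; exact h.1 i h8 h9 h10, by simpa using h.2⟩)
    (fun l' τ a h => ⟨fun i h8 h9 h10 => by
      rw [Function.update_of_ne h9]; exact h.1 i h8 h9 h10, by simpa using h.2⟩)
    (fun l' τ h => by rw [h.1 N (by simp) (by simp) (by simp), he])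
    (fun z l' τ h hz => by
      have hc : τ (N + 7) = σ (N + 7) := h.1 _ (by simp) (by simp) (by simp)
      by_cases hzc : z = σ (N + 7)
      · refine ⟨_, Det.ifEq_pos (by rw [hz, hc, hzc]) ((det_pop _ _).seq ((det_pop _ _).seq
          ((det_pop _ _).seq ((det_pop _ _).seq (det_pop _ _))))), ⟨fun i h8 h9 h10 => ?_, ?_⟩, ?_⟩
        · simpa [h10] using h.1 i h8 h9 h10
        · rw [← h.2]
          simp [hzc]
          omega
        · simp
      · refine ⟨τ, (Det.ifEq_neg (by rwa [hz, hc]) (det_skip τ)).mono (by omega), ⟨h.1, ?_⟩, rfl⟩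
        rw [← h.2, List.count_cons_of_ne hzc])
    l σ hl ⟨fun _ _ _ _ => rfl, rfl⟩ hs hy
  exact ⟨σ', hdet, h₁, h₃, by simpa using h₂⟩

/-- Makes the candidate the result if it has at least `60%` of the votes. -/
def testCandidate (N : ℕ) : Cmd :=
  .seq (.copy (N + 10) (N + 5)) (.seq (.copy (N + 8) (N + 4)) (.seq (countVotes N)
    (.ifEq (N + 10) N (.copy (N + 11) (N + 7)) .skip)))

/-- Computes the result of the vote from the outputs of the runs. -/
def voteProgram (N : ℕ) : Cmd :=
  .seq (.copy (N + 6) (N + 4)) (.seq (forEach (N + 6) (N + 7) N (testCandidate N))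
    (.copy 2 (N + 11)))

/-- The variables of the voting program when it holds the input `(1ⁿ, x)` and the outputs `l` of
the runs made so far, in reverse order. -/
structure VoteState (N n : ℕ) (x : List Bool) (l : List (List Bool)) (σ : ℕ → List Bool) :
    Prop where
  empty : σ N = []
  input₀ : σ (N + 1) = List.replicate n true
  input₁ : σ (N + 2) = x
  runs : σ (N + 4) = encodeItems l
  threshold : (σ (N + 5)).length = 3 * l.length
  candidate : σ (N + 7) = []
  ballot : σ (N + 9) = []
  result : σ (N + 11) = []

theorem det_testCandidate {N M : ℕ} {l : List (List Bool)} {σ : ℕ → List Bool}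
    (hl : ∀ z ∈ l, z.length ≤ M) (he : σ N = []) (hs : σ (N + 4) = encodeItems l)
    (hth : (σ (N + 5)).length = 3 * l.length) (hy : σ (N + 9) = []) :
    ∃ σ', Det (testCandidate N) σ (l.length * (9 * M + 16) + 8) σ' ∧
      (∀ i, i ≠ N + 8 → i ≠ N + 9 → i ≠ N + 10 → i ≠ N + 11 → σ' i = σ i) ∧ σ' (N + 9) = [] ∧
      σ' (N + 11) =
        if 3 * l.length ≤ 5 * l.count (σ (N + 7)) then σ (N + 7) else σ (N + 11) := by
  set σ₁ := Function.update (Function.update σ (N + 10) (σ (N + 5))) (N + 8) (σ (N + 4)) with hσ₁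
  have hcopy₁ := det_copy (N + 10) (N + 5) σ
  have hcopy₂ : Det (.copy (N + 8) (N + 4)) (Function.update σ (N + 10) (σ (N + 5))) 1 σ₁ := by
    simpa [hσ₁] using det_copy (N + 8) (N + 4) (Function.update σ (N + 10) (σ (N + 5)))
  obtain ⟨σ₂, hdet, h₁, h₂, h₃⟩ := det_countVotes (N := N) (σ := σ₁) hl (by simp [hσ₁, he])
    (by simp [hσ₁, hs]) (by simp [hσ₁, hy])
  have hold : ∀ i, i ≠ N + 8 → i ≠ N + 9 → i ≠ N + 10 → σ₂ i = σ i := fun i h8 h9 h10 => by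
    rw [h₁ i h8 h9 h10]; simp [hσ₁, h8, h10]
  have hlen : (σ₂ (N + 10)).length = 3 * l.length - 5 * l.count (σ (N + 7)) := by
    rw [h₃]; simp [hσ₁, hth]
  have he₂ : σ₂ N = [] := by rw [hold N (by simp) (by simp) (by simp), he]
  by_cases hq : 3 * l.length ≤ 5 * l.count (σ (N + 7))
  · have h10 : σ₂ (N + 10) = σ₂ N := by
      rw [he₂]; exact List.length_eq_zero_iff.1 (by omega)
    refine ⟨_, (hcopy₁.seq (hcopy₂.seq (hdet.seq (Det.ifEq_pos h10 (det_copy _ _ _))))).mono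
      (by omega), fun i h8 h9 h10 h11 => ?_, ?_, ?_⟩
    · simp [h11, hold i h8 h9 h10]
    · simp [h₂]
    · simp [hq, hold (N + 7)]
  · have h10 : σ₂ (N + 10) ≠ σ₂ N := by
      rw [he₂]; intro h; rw [h] at hlen; simp at hlen; omega
    refine ⟨_, (hcopy₁.seq (hcopy₂.seq (hdet.seq (Det.ifEq_neg h10 (det_skip _))))).mono
      (by omega), fun i h8 h9 h10 h11 => hold i h8 h9 h10, h₂, ?_⟩
    rw [if_neg hq, hold (N + 11) (by simp) (by simp) (by simp)]

theorem det_voteProgram {N n M : ℕ} {x : List Bool} {l : List (List Bool)} {σ : ℕ → List Bool}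
    (hσ : VoteState N n x l σ) (hl : ∀ z ∈ l, z.length ≤ M) :
    ∃ σ', Det (voteProgram N) σ
      (l.length * (9 * M + (l.length * (9 * M + 16) + 8) + 6) + 5) σ' ∧ σ' 2 = voteLast l := by
  set σ₁ := Function.update σ (N + 6) (σ (N + 4)) with hσ₁
  let q : List Bool → List Bool → List Bool :=
    fun acc y => if 3 * l.length ≤ 5 * l.count y then y else acc
  let I : List (List Bool) → (ℕ → List Bool) → Prop := fun l' τ =>
    τ N = [] ∧ τ (N + 4) = encodeItems l ∧ (τ (N + 5)).length = 3 * l.length ∧ τ (N + 9) = [] ∧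
      l'.foldl q (τ (N + 11)) = voteLast l
  obtain ⟨σ₂, hdet, hI, -⟩ := det_forEach (s := N + 6) (y := N + 7) (e := N)
    (body := testCandidate N) (t := l.length * (9 * M + 16) + 8) (M := M) (by simp) I
    (fun l' τ a h => by simpa [I] using h)
    (fun l' τ a h => by simpa [I] using h)
    (fun l' τ h => h.1)
    (fun z l' τ h hz => by
      obtain ⟨he, hs, hth, hy, hr⟩ := h
      obtain ⟨τ', hdet, h₁, h₂, h₃⟩ := det_testCandidate hl he hs hth hy
      refine ⟨τ', hdet, ⟨?_, ?_, ?_, h₂, ?_⟩, h₁ _ (by simp) (by simp) (by simp) (by simp)⟩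
      · rw [h₁ _ (by simp) (by simp) (by simp) (by simp), he]
      · rw [h₁ _ (by simp) (by simp) (by simp) (by simp), hs]
      · rw [h₁ _ (by simp) (by simp) (by simp) (by simp), hth]
      · rw [h₃, hz, ← hr]; rfl)
    l σ₁ hl ⟨by simp [hσ₁, hσ.empty], by simp [hσ₁, hσ.runs], by simp [hσ₁, hσ.threshold],
      by simp [hσ₁, hσ.ballot], by simp [hσ₁, hσ.result]; rfl⟩ (by simp [hσ₁, hσ.runs])
    (by simp [hσ₁, hσ.candidate])
  refine ⟨_, ((det_copy _ _ _).seq (hdet.seq (det_copy _ _ _))).mono (by omega), ?_⟩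
  simpa using hI.2.2.2.2

/-! ### Repeated sampling -/

/-- Empties the variables below `k`. The variable `e` is assumed to be empty. -/
def clearBelow (e : ℕ) : ℕ → Cmd
  | 0 => .skip
  | k + 1 => .seq (clearBelow e k) (.copy k e)

theorem det_clearBelow {e k : ℕ} {σ : ℕ → List Bool} (he : σ e = []) (hk : k ≤ e) :
    Det (clearBelow e k) σ (2 * k + 1) (fun i => if i < k then [] else σ i) := by
  induction k with
  | zero => simpa [clearBelow] using det_skip σ
  | succ k ih =>
    have h := (ih (by omega)).seq (det_copy k e _)
    have h' : Det (clearBelow e (k + 1)) σ (2 * (k + 1) + 1) _ := h.mono (by omega)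
    convert h' using 1
    funext i
    rcases lt_trichotomy i k with hi | rfl | hi
    · simp [hi, hi.ne, hi.trans (Nat.lt_succ_self k)]
    · simp [he, (Nat.lt_of_succ_le hk).not_gt]
    · simp [hi.ne', hi.not_gt, Nat.not_lt.2 (Nat.succ_le_of_lt hi)]

/-- Puts the variables below `N` into the state in which a machine starts. -/
def prepareInput (N : ℕ) : Cmd :=
  .seq (clearBelow N N) (.seq (.copy 0 (N + 1)) (.copy 1 (N + 2)))

theorem det_prepareInput {N n : ℕ} {x : List Bool} {l : List (List Bool)} {σ : ℕ → List Bool}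
    (hN : 3 ≤ N) (hσ : VoteState N n x l σ) (P : Cmd) (ψ : QState) :
    Det (prepareInput N) σ (2 * N + 5) (merge N (initConfig P ψ n x).store σ) := by
  have h := (det_clearBelow hσ.empty le_rfl).seq
    ((det_copy 0 (N + 1) _).seq (det_copy 1 (N + 2) _))
  have h' : Det (prepareInput N) σ (2 * N + 5) _ := h.mono (by omega)
  convert h' using 1
  funext i
  rcases Nat.lt_or_ge i N with hi | hi
  · rcases i with _ | _ | i <;> simp [merge, initConfig, hi, hσ.input₀, hσ.input₁]
  · simp [merge, hi.not_gt, show i ≠ 0 by omega, show i ≠ 1 by omega]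

theorem HaltsWith.seq {c d : Cmd} {K : List Cmd} {σ : ℕ → List Bool} {ψ : QState} {t : ℕ}
    {D : PMF (List Bool)} (h : HaltsWith ⟨c :: d :: K, σ, ψ⟩ t D) :
    HaltsWith ⟨.seq c d :: K, σ, ψ⟩ (1 + t) D :=
  .of_runFor_eq_pure (by simp [runFor, BotPRG.step]) h

theorem HaltsWith.qinit {K : List Cmd} {σ : ℕ → List Bool} {ψ : QState} {t : ℕ}
    {D : PMF (List Bool)} (h : HaltsWith ⟨K, σ, ket ∅⟩ t D) :
    HaltsWith ⟨.qinit :: K, σ, ψ⟩ (1 + t) D :=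
  .of_runFor_eq_pure (by simp [runFor, BotPRG.step]) h

theorem HaltsWith.while_cons {x : ℕ} {c : Cmd} {K : List Cmd} {σ : ℕ → List Bool} {ψ : QState}
    {t : ℕ} {D : PMF (List Bool)} (hx : σ x ≠ [])
    (h : HaltsWith ⟨c :: .whileNonempty x c :: K, σ, ψ⟩ t D) :
    HaltsWith ⟨.whileNonempty x c :: K, σ, ψ⟩ (1 + t) D :=
  .of_runFor_eq_pure (by simp [runFor, BotPRG.step, hx]) h

/-- Stores the output of a run and the three bits that go with it. -/
def recordRun (N : ℕ) : Cmd :=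
  .seq (pushItem 2 (N + 4)) (.seq (.push (N + 5) true) (.seq (.push (N + 5) true)
    (.seq (.push (N + 5) true) (.pop (N + 3)))))

theorem det_recordRun {N n M : ℕ} {x y : List Bool} {l : List (List Bool)} {σ τ : ℕ → List Bool}
    (hN : 3 ≤ N) (hσ : VoteState N n x l σ) (hτ : τ 2 = y) (hy : y.length ≤ M) :
    ∃ σ', Det (recordRun N) (merge N τ σ) (7 * M + 11) σ' ∧ VoteState N n x (y :: l) σ' ∧
      σ' (N + 3) = (σ (N + 3)).tail := by
  have h2 : merge N τ σ 2 = y := by rw [merge_of_lt _ _ (by omega), hτ]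
  have hm : ∀ j, merge N τ σ (N + j) = σ (N + j) := fun j => merge_of_le _ _ (by omega)
  have hne : ∀ j, N + j ≠ 2 := fun j => by omega
  refine ⟨_, ((det_pushItem (by omega) _).seq ((det_push _ _ _).seq ((det_push _ _ _).seq
    ((det_push _ _ _).seq (det_pop _ _))))).mono (by rw [h2]; omega), ?_, ?_⟩
  · have hN0 : N ≠ 0 := by omega
    have hN2 : N ≠ 2 := by omega
    have hm0 : merge N τ σ N = σ N := hm 0
    constructor <;>
      simp [hm, hne, hN0, hN2, hm0, h2, hσ.empty, hσ.input₀, hσ.input₁, hσ.runs, hσ.threshold,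
        hσ.candidate, hσ.ballot, hσ.result, encodeItems_cons]
    omega
  · simp [hm, hne]

/-- Makes one run of `P` on fresh variables and a fresh register, and stores its output. -/
def sampleOnce (P : Cmd) (N : ℕ) : Cmd :=
  .seq (prepareInput N) (.seq .qinit (.seq P (recordRun N)))

theorem haltsWith_sampleOnce {P : Cmd} {N n t M T : ℕ} {x : List Bool} {D : PMF (List Bool)}
    {l : List (List Bool)} {σ : ℕ → List Bool} {ψ : QState} {K : List Cmd}
    {F : List Bool → PMF (List Bool)} (hN : 3 ≤ N) (hPN : P.varBound ≤ N)
    (hP : RunsTo P (ket ∅) n x t D) (hM : ∀ y ∈ D.support, y.length ≤ M)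
    (hσ : VoteState N n x l σ)
    (hK : ∀ y ∈ D.support, ∀ σ' ψ', VoteState N n x (y :: l) σ' →
      σ' (N + 3) = (σ (N + 3)).tail → HaltsWith ⟨K, σ', ψ'⟩ T (F y)) :
    HaltsWith ⟨sampleOnce P N :: K, σ, ψ⟩ (2 * N + t + 7 * M + T + 20) (D.bind F) := by
  have hrun := HaltsWith.within (N := N) (K := recordRun N :: K) (τ := σ) (F := F)
    (T := 7 * M + 11 + T) t (initConfig P (ket ∅) n x) (by simpa [initConfig] using hPN) hP.1
    (fun c' hc' => by
      have hy : c'.store 2 ∈ D.support := by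
        rw [← hP.2, PMF.support_map]; exact ⟨c', hc', rfl⟩
      obtain ⟨σ', hdet, h₁, h₂⟩ := det_recordRun hN hσ rfl (hM _ hy)
      exact hdet.haltsWith (hK _ hy σ' _ h₁ h₂))
  rw [← hP.2, PMF.bind_map]
  refine HaltsWith.mono (HaltsWith.seq ((det_prepareInput hN hσ P (ket ∅)).haltsWith
    (HaltsWith.seq (HaltsWith.qinit (HaltsWith.seq hrun))))) (by omega)

theorem iid_succ_bind {α β : Type} (p : PMF α) (m : ℕ) (g : List α → PMF β) :
    (iid p (m + 1)).bind g = p.bind fun y => (iid p m).bind fun ys => g (y :: ys) := by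
  simp only [iid, PMF.bind_bind, PMF.bind_map]
  rfl

theorem haltsWith_sampling {P : Cmd} {N n t M T : ℕ} {x : List Bool} {D : PMF (List Bool)}
    {K : List Cmd} {F : List (List Bool) → PMF (List Bool)} (hN : 3 ≤ N) (hPN : P.varBound ≤ N)
    (hP : RunsTo P (ket ∅) n x t D) (hM : ∀ y ∈ D.support, y.length ≤ M)
    (hK : ∀ l σ ψ, VoteState N n x l σ → l.length = n → (∀ y ∈ l, y.length ≤ M) →
      HaltsWith ⟨K, σ, ψ⟩ T (F l))
    (m : ℕ) (l : List (List Bool)) (σ : ℕ → List Bool) (ψ : QState) (hσ : VoteState N n x l σ)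
    (hm : (σ (N + 3)).length = m) (hlm : l.length + m = n) (hl : ∀ y ∈ l, y.length ≤ M) :
    HaltsWith ⟨.whileNonempty (N + 3) (sampleOnce P N) :: K, σ, ψ⟩
      (m * (2 * N + t + 7 * M + 21) + T + 1) ((iid D m).bind fun ys => F (ys.reverse ++ l)) := by
  induction m generalizing l σ ψ with
  | zero =>
    have h := (det_while_nil (c := sampleOnce P N) (List.length_eq_zero_iff.1 hm)).haltsWith
      (hK l σ ψ hσ (by simpa using hlm) hl)
    simpa [iid, PMF.pure_bind] using h.mono (by omega)
  | succ m ih =>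
    rw [iid_succ_bind]
    simp only [List.reverse_cons, List.append_assoc, List.singleton_append]
    have h := haltsWith_sampleOnce (ψ := ψ)
      (K := .whileNonempty (N + 3) (sampleOnce P N) :: K)
      (F := fun y => (iid D m).bind fun ys => F (ys.reverse ++ y :: l)) hN hPN hP hM hσ
      (fun y hy σ' ψ' hσ' htail => ih (y :: l) σ' ψ' hσ' (by rw [htail]; simp [hm])
        (by simp only [List.length_cons]; omega)
        (fun z hz => by
          rcases List.mem_cons.1 hz with rfl | hz
          exacts [hM _ hy, hl _ hz]))
    refine (HaltsWith.while_cons (fun h0 => by simp [h0] at hm) h).mono ?_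
    simp only [Nat.add_mul]
    omega

/-- Runs `P`, which uses variables below `N`, independently `n` times on the input and takes the
vote. -/
def voteMachine (P : Cmd) (N : ℕ) : Cmd :=
  .seq (.copy (N + 1) 0) (.seq (.copy (N + 2) 1) (.seq (.copy (N + 3) 0)
    (.seq (.whileNonempty (N + 3) (sampleOnce P N)) (voteProgram N))))

theorem runsTo_voteMachine {P : Cmd} {N n t M : ℕ} {x : List Bool} {D : PMF (List Bool)}
    (hN : 3 ≤ N) (hPN : P.varBound ≤ N) (hP : RunsTo P (ket ∅) n x t D)
    (hM : ∀ y ∈ D.support, y.length ≤ M) :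
    RunsTo (voteMachine P N) (ket ∅) n x
      (n * (2 * N + t + 7 * M + 21) + n * (9 * M + (n * (9 * M + 16) + 8) + 6) + 13)
      ((iid D n).map fun ys => (vote ys).getD []) := by
  set σ := (initConfig (voteMachine P N) (ket ∅) n x).store with hσ
  have hσ0 : σ 0 = List.replicate n true := rfl
  have hσ1 : σ 1 = x := rfl
  have hσN : ∀ j, σ (N + j) = [] := fun j => by
    simp [hσ, initConfig, show ¬ (N = 0 ∧ j = 0) by omega, show N + j ≠ 1 by omega]
  have hσN0 : σ N = [] := hσN 0
  have hloop := haltsWith_sampling (K := [voteProgram N]) (F := fun l => PMF.pure (voteLast l))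
    (T := n * (9 * M + (n * (9 * M + 16) + 8) + 6) + 5 + 0) hN hPN hP hM
    (fun l τ ψ hτ hln hl => by
      obtain ⟨τ', hdet, h2⟩ := det_voteProgram hτ hl
      rw [hln] at hdet
      have h := hdet.haltsWith (ψ := ψ) (haltsWith_nil 0 τ' ψ)
      rwa [h2] at h)
    n [] (Function.update (Function.update (Function.update σ (N + 1) (σ 0)) (N + 2) (σ 1))
      (N + 3) (σ 0)) (ket ∅)
    (by constructor <;> simp [hσN, hσN0, hσ0, hσ1, encodeItems])
    (by simp [hσ0]) (by simp) (by simp)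
  have hc₁ := det_copy (N + 1) 0 σ
  have hc₂ : Det (.copy (N + 2) 1) (Function.update σ (N + 1) (σ 0)) 1
      (Function.update (Function.update σ (N + 1) (σ 0)) (N + 2) (σ 1)) := by
    have h := det_copy (N + 2) 1 (Function.update σ (N + 1) (σ 0))
    rwa [Function.update_of_ne (show (1 : ℕ) ≠ N + 1 by omega)] at h
  have hc₃ : Det (.copy (N + 3) 0)
      (Function.update (Function.update σ (N + 1) (σ 0)) (N + 2) (σ 1)) 1
      (Function.update (Function.update (Function.update σ (N + 1) (σ 0)) (N + 2) (σ 1))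
        (N + 3) (σ 0)) := by
    simpa using det_copy (N + 3) 0
      (Function.update (Function.update σ (N + 1) (σ 0)) (N + 2) (σ 1))
  have h := HaltsWith.seq (hc₁.haltsWith (HaltsWith.seq (hc₂.haltsWith (HaltsWith.seq
    (hc₃.haltsWith (HaltsWith.seq hloop))))))
  have hD : ((iid D n).bind fun ys => PMF.pure (voteLast (ys.reverse ++ []))) =
      (iid D n).map fun ys => (vote ys).getD [] := by
    simp only [List.append_nil, voteLast_reverse]
    rfl
  rw [hD] at h
  exact h.mono (by omega)

theorem IsQPT.vote {D : Behaviour} (hD : IsQPT D) :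
    IsQPT fun n x => (iid (D n x) n).map fun ys => (BotPRG.vote ys).getD [] := by
  obtain ⟨P, p, hP⟩ := hD
  set N := max 3 P.varBound
  refine ⟨voteMachine P N, Polynomial.X *
      (2 * (N : Polynomial ℕ) + p + 7 * (Polynomial.X + p) + 21) +
      Polynomial.X * (9 * (Polynomial.X + p) +
        (Polynomial.X * (9 * (Polynomial.X + p) + 16) + 8) + 6) + 13, fun n x => ?_⟩
  have h := runsTo_voteMachine (le_max_left 3 P.varBound) (le_max_right 3 P.varBound) (hP n x)
    (length_le_of_runsTo (hP n x))
  refine HaltsWith.mono h ?_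
  simp only [Polynomial.eval_add, Polynomial.eval_mul, Polynomial.eval_X, Polynomial.eval_natCast,
    Polynomial.eval_ofNat, Nat.cast_id]
  have hn : n ≤ n + x.length := Nat.le_add_right _ _
  gcongr

/-- Votes on encoded outputs are encoded votes. -/
theorem vote_map {α β : Type} [DecidableEq α] [DecidableEq β] {f : α → β}
    (hf : Function.Injective f) (ys : List α) : vote (ys.map f) = (vote ys).map f := by
  simp only [vote, List.find?_map, List.length_map]
  congr 2
  funext y
  simp only [Function.comp, List.count_map_of_injective _ _ hf]

theorem iid_map {α β : Type} (p : PMF α) (f : α → β) (m : ℕ) :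
    iid (p.map f) m = (iid p m).map (List.map f) := by
  induction m with
  | zero => simp [iid, PMF.pure_map]
  | succ m ih => simp only [iid, PMF.bind_map, PMF.map_bind, ih, PMF.map_comp]; rfl

theorem encBits_injective (n : ℕ) : Function.Injective (encBits (n := n)) :=
  fun _ _ h => List.ofFn_injective h

theorem QPTFamily.Gvote {ℓ : ℕ → ℕ} {G : ∀ n, Bits n → PMF (Bits (ℓ n))}
    (hG : QPTFamily (fun _ => encBits) G) : QPTFamily (fun _ => encBot) (BotPRG.Gvote G) := by
  obtain ⟨D, hD, h⟩ := hG
  refine ⟨_, hD.vote, fun n k => ?_⟩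
  simp only [h, iid_map, PMF.map_comp, BotPRG.Gvote]
  congr 1
  funext ys
  simp only [Function.comp, vote_map (encBits_injective _)]
  cases BotPRG.vote ys <;> rfl

open scoped ENNReal NNReal

/-! ### Tail bounds for repeated samples -/

theorem toOuterMeasure_add_compl {α : Type*} (p : PMF α) (S : Set α) :
    p.toOuterMeasure S + p.toOuterMeasure Sᶜ = 1 := by
  rw [PMF.toOuterMeasure_apply, PMF.toOuterMeasure_apply, ← ENNReal.tsum_add, ← p.tsum_coe]
  exact tsum_congr fun x => Set.indicator_self_add_compl_apply S p x

theorem toOuterMeasure_le_one {α : Type*} (p : PMF α) (S : Set α) : p.toOuterMeasure S ≤ 1 :=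
  (toOuterMeasure_add_compl p S) ▸ le_self_add

theorem one_sub_le_toReal_toOuterMeasure {α : Type*} (p : PMF α) (S : Set α) (r : ℝ≥0)
    (h : p.toOuterMeasure Sᶜ ≤ r) : 1 - (r : ℝ) ≤ (p.toOuterMeasure S).toReal := by
  have hS := ne_top_of_le_ne_top ENNReal.one_ne_top (toOuterMeasure_le_one p S)
  have hSc := ne_top_of_le_ne_top ENNReal.one_ne_top (toOuterMeasure_le_one p Sᶜ)
  have h1 := congrArg ENNReal.toReal (toOuterMeasure_add_compl p S)
  rw [ENNReal.toReal_add hS hSc, ENNReal.toReal_one] at h1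
  have h2 : (p.toOuterMeasure Sᶜ).toReal ≤ r := by
    simpa using ENNReal.toReal_mono ENNReal.coe_ne_top h
  linarith

/-- The expectation of a nonnegative function. -/
noncomputable def expect {α : Type*} (p : PMF α) (f : α → ℝ≥0∞) : ℝ≥0∞ := ∑' a, p a * f a

theorem expect_pure {α : Type*} (a : α) (f : α → ℝ≥0∞) : expect (PMF.pure a) f = f a := by
  rw [expect, tsum_eq_single a (fun b hb => by simp [PMF.pure_apply, hb])]
  simp

theorem expect_bind {α β : Type*} (p : PMF α) (q : α → PMF β) (f : β → ℝ≥0∞) :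
    expect (p.bind q) f = expect p fun a => expect (q a) f := by
  simp only [expect, PMF.bind_apply, ← ENNReal.tsum_mul_right, ← ENNReal.tsum_mul_left]
  rw [ENNReal.tsum_comm]
  simp only [mul_assoc]

theorem expect_map {α β : Type*} (p : PMF α) (g : α → β) (f : β → ℝ≥0∞) :
    expect (p.map g) f = expect p fun a => f (g a) := by
  rw [PMF.map, expect_bind]
  simp only [Function.comp, expect_pure]

theorem expect_add {α : Type*} (p : PMF α) (f g : α → ℝ≥0∞) :
    expect p (fun a => f a + g a) = expect p f + expect p g := by
  simp only [expect, mul_add, ENNReal.tsum_add]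

theorem expect_const_mul {α : Type*} (p : PMF α) (c : ℝ≥0∞) (f : α → ℝ≥0∞) :
    expect p (fun a => c * f a) = c * expect p f := by
  simp only [expect, mul_left_comm _ c, ENNReal.tsum_mul_left]

theorem expect_const {α : Type*} (p : PMF α) (c : ℝ≥0∞) : expect p (fun _ => c) = c := by
  simp [expect, ENNReal.tsum_mul_right]

theorem expect_ite {α : Type*} (p : PMF α) (q : α → Prop) [DecidablePred q] (c : ℝ≥0∞) :
    expect p (fun a => if q a then c else 0) = p.toOuterMeasure {a | q a} * c := by
  rw [expect, PMF.toOuterMeasure_apply, ← ENNReal.tsum_mul_right]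
  refine tsum_congr fun a => ?_
  by_cases h : q a <;> simp [h]

theorem toOuterMeasure_mul_le_expect {α : Type*} (p : PMF α) {f : α → ℝ≥0∞} {S : Set α} {t : ℝ≥0∞}
    (h : ∀ a ∈ S, t ≤ f a) : p.toOuterMeasure S * t ≤ expect p f := by
  rw [expect, PMF.toOuterMeasure_apply, ← ENNReal.tsum_mul_right]
  refine ENNReal.tsum_le_tsum fun a => ?_
  by_cases ha : a ∈ S
  · simp only [ha, Set.indicator_of_mem]
    gcongr
    exact h a ha
  · simp [ha]

/-- A function of a list that vanishes if no entry satisfies `q`, and otherwise is at least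
`(1 + d)` to the power of the number of these entries. -/
noncomputable def tailWeight {α : Type} (q : α → Prop) [DecidablePred q] (d : ℝ≥0∞) : List α → ℝ≥0∞
  | [] => 0
  | y :: ys => tailWeight q d ys + if q y then d * tailWeight q d ys + (1 + d) else 0

theorem pow_countP_le_tailWeight {α : Type} (q : α → Prop) [DecidablePred q] (d : ℝ≥0∞)
    (ys : List α) (h : 1 ≤ ys.countP fun y => q y) :
    (1 + d) ^ (ys.countP fun y => q y) ≤ tailWeight q d ys := by
  induction ys with
  | nil => simp at h
  | cons y ys ih =>
    by_cases hy : q y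
    · rw [List.countP_cons_of_pos (by simpa using hy), tailWeight, if_pos hy]
      rcases Nat.eq_zero_or_pos (ys.countP fun y => q y) with h0 | h0
      · rw [h0, zero_add, pow_one]
        exact le_add_left le_add_self
      · calc (1 + d) ^ ((ys.countP fun y => q y) + 1)
            = (1 + d) ^ (ys.countP fun y => q y) + d * (1 + d) ^ (ys.countP fun y => q y) := by
              ring
          _ ≤ tailWeight q d ys + d * tailWeight q d ys := by gcongr <;> exact ih h0
          _ ≤ _ := by gcongr; exact le_self_add
    · rw [List.countP_cons_of_neg (by simpa using hy)] at h ⊢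
      rw [tailWeight, if_neg hy, add_zero]
      exact ih h

/-- The expectation of `tailWeight` is at most proportional to the probability `π` of `q`: it is at
most `π * C * ((1 + d * β) ^ m - 1)`, stated without subtraction. -/
theorem expect_tailWeight_add_le {α : Type} (p : PMF α) (q : α → Prop) [DecidablePred q]
    {d β C : ℝ≥0∞} (hβ : p.toOuterMeasure {a | q a} ≤ β) (hC : 1 + d + C ≤ (1 + d * β) * C)
    (m : ℕ) :
    expect (iid p m) (tailWeight q d) + p.toOuterMeasure {a | q a} * C ≤
      p.toOuterMeasure {a | q a} * C * (1 + d * β) ^ m := by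
  induction m with
  | zero => simp [iid, expect_pure, tailWeight]
  | succ m ih =>
    set π := p.toOuterMeasure {a | q a}
    set w := expect (iid p m) (tailWeight q d)
    have hw : expect (iid p (m + 1)) (tailWeight q d) = w + π * (d * w + (1 + d)) := by
      simp only [iid, expect_bind, expect_map, tailWeight, expect_add]
      have : ∀ a, (expect (iid p m) fun ys =>
          if q a then d * tailWeight q d ys + (1 + d) else 0) =
          if q a then d * w + (1 + d) else 0 := fun a => by
        by_cases h : q a
        · simp only [h, if_true, expect_add, expect_const_mul, expect_const, w]
        · simp only [h, if_false, expect_const]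
      simp only [this, expect_ite, expect_const, w, π]
    calc expect (iid p (m + 1)) (tailWeight q d) + π * C
        = (1 + d * π) * w + π * (1 + d + C) := by rw [hw]; ring
      _ ≤ (1 + d * β) * w + π * ((1 + d * β) * C) := by gcongr
      _ = (1 + d * β) * (w + π * C) := by ring
      _ ≤ (1 + d * β) * (π * C * (1 + d * β) ^ m) := by gcongr
      _ = π * C * (1 + d * β) ^ (m + 1) := by ring

/-- An exponential tail bound for the number of samples with a property `q` of probability at most
`β`, with a factor for the probability of `q` that makes it summable over many properties. The
property is required of a fraction `j / 5` of the samples, where `tailWeight` is at least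
`b ^ (j * m)`; hence the fifth power in the choice of `d`. -/
theorem toOuterMeasure_tail_le {α : Type} (p : PMF α) (q : α → Prop) [DecidablePred q]
    {b d β C ρ : ℝ≥0} {j : ℕ} (hβ : p.toOuterMeasure {a | q a} ≤ β) (hb : 1 ≤ b)
    (hd : 1 + d = b ^ 5) (hC : 1 + d + C ≤ (1 + d * β) * C) (hρ : 1 + d * β ≤ ρ * b ^ j) (m : ℕ) :
    (iid p m).toOuterMeasure
        {ys | 1 ≤ (ys.countP fun y => q y) ∧ j * m ≤ 5 * ys.countP fun y => q y} ≤
      p.toOuterMeasure {a | q a} * (C * ρ ^ m : ℝ≥0) := by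
  set π := p.toOuterMeasure {a | q a}
  have h₁ := toOuterMeasure_mul_le_expect (iid p m) (f := tailWeight q d)
    (S := {ys | 1 ≤ (ys.countP fun y => q y) ∧ j * m ≤ 5 * ys.countP fun y => q y})
    (t := ((b ^ j) ^ m : ℝ≥0)) (fun ys hys => by
      refine le_trans ?_ (pow_countP_le_tailWeight q d ys hys.1)
      rw [← ENNReal.coe_one, ← ENNReal.coe_add, ← ENNReal.coe_pow, ENNReal.coe_le_coe, hd,
        ← pow_mul, ← pow_mul]
      exact pow_le_pow_right₀ hb hys.2)
  have h₂ := expect_tailWeight_add_le p q (d := d) (C := C) hβ (by exact_mod_cast hC) m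
  have h₃ : (1 + (d : ℝ≥0∞) * β) ^ m ≤ ((ρ ^ m : ℝ≥0) : ℝ≥0∞) * ((b ^ j) ^ m : ℝ≥0) := by
    have h := ENNReal.coe_le_coe.2 (pow_le_pow_left₀ zero_le hρ m)
    rw [mul_pow] at h
    push_cast at h ⊢
    exact h
  have hb0 : (((b ^ j) ^ m : ℝ≥0) : ℝ≥0∞) ≠ 0 := by
    have : b ≠ 0 := (zero_lt_one.trans_le hb).ne'
    simp [this]
  refine (ENNReal.mul_le_mul_iff_left hb0 ENNReal.coe_ne_top).1 ?_
  calc _ ≤ expect (iid p m) (tailWeight q d) := h₁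
    _ ≤ π * C * (1 + d * β) ^ m := le_self_add.trans h₂
    _ ≤ π * C * (((ρ ^ m : ℝ≥0) : ℝ≥0∞) * ((b ^ j) ^ m : ℝ≥0)) := by gcongr
    _ = _ := by rw [ENNReal.coe_mul]; ring

/-! ### The result of a vote -/

theorem length_of_mem_support_iid {α : Type} (p : PMF α) (m : ℕ) :
    ∀ ys ∈ (iid p m).support, ys.length = m := by
  induction m with
  | zero => simp [iid]
  | succ m ih =>
    intro ys hys
    rw [iid, PMF.mem_support_bind_iff] at hys
    obtain ⟨y, -, hys⟩ := hys
    rw [PMF.support_map] at hys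
    obtain ⟨ys, hys, rfl⟩ := hys
    simp [ih ys hys]

theorem le_count_of_vote {α : Type} [DecidableEq α] {ys : List α} {y : α} (h : vote ys = some y) :
    1 ≤ ys.count y ∧ 3 * ys.length ≤ 5 * ys.count y := by
  have h₁ := List.find?_some h
  have h₂ := List.mem_of_find?_eq_some h
  simp only [decide_eq_true_eq] at h₁
  exact ⟨List.count_pos_iff.2 h₂, by omega⟩

theorem count_add_count_le {α : Type} [DecidableEq α] {y z : α} (h : y ≠ z) (ys : List α) :
    ys.count y + ys.count z ≤ ys.length := by
  induction ys with
  | nil => simp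
  | cons x ys ih =>
    simp only [List.count_cons, List.length_cons, beq_iff_eq]
    split_ifs with h₁ h₂ <;> first | omega | exact absurd (h₁.symm.trans h₂) h

theorem vote_eq_some {α : Type} [DecidableEq α] {ys : List α} {y : α} (h : 1 ≤ ys.length)
    (hy : 3 * ys.length ≤ 5 * ys.count y) : vote ys = some y := by
  have hmem : y ∈ ys := List.count_pos_iff.1 (by omega)
  cases hv : vote ys with
  | none =>
    have := List.find?_eq_none.1 hv y hmem
    simp only [decide_eq_true_eq] at this
    omega
  | some z =>
    by_contra hne
    have h₁ := (le_count_of_vote hv).2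
    have h₂ := count_add_count_le (fun hzy => hne (congrArg some hzy) : z ≠ y) ys
    omega

/-- An exponentially small bound for the error of a vote among `m` samples. -/
noncomputable def voteError (m : ℕ) : ℝ≥0 := 12 * (99 / 100) ^ m

theorem one_sub_voteError_le_of_likely {α : Type} [DecidableEq α] (p : PMF α) (y : α)
    (hy : 9 / 10 ≤ (p y).toReal) {m : ℕ} (hm : 1 ≤ m) :
    1 - (voteError m : ℝ) ≤ (((iid p m).map vote) (some y)).toReal := by
  rw [← PMF.toOuterMeasure_apply_singleton]
  refine one_sub_le_toReal_toOuterMeasure _ _ _ ?_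
  have hβ : p.toOuterMeasure {a | a ≠ y} ≤ ((1 / 10 : ℝ≥0) : ℝ≥0∞) := by
    have h₁ := toOuterMeasure_add_compl p {y}
    rw [PMF.toOuterMeasure_apply_singleton] at h₁
    have hfin := ne_top_of_le_ne_top ENNReal.one_ne_top (toOuterMeasure_le_one p {y}ᶜ)
    have h₂ := congrArg ENNReal.toReal h₁
    rw [ENNReal.toReal_add (p.apply_ne_top y) hfin, ENNReal.toReal_one] at h₂
    change p.toOuterMeasure {y}ᶜ ≤ _
    rw [← ENNReal.coe_toNNReal hfin, ENNReal.coe_le_coe, ← NNReal.coe_le_coe]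
    change (p.toOuterMeasure {y}ᶜ).toReal ≤ _
    norm_num
    linarith
  -- Here `d = b ^ 5 - 1`, and `(1 + d / 10) / b ^ 2 < 3 / 4` is below `ρ`.
  have htail := toOuterMeasure_tail_le p (fun a => a ≠ y) (b := 3 / 2) (d := 659375 / 100000)
    (C := 12) (ρ := 99 / 100) (j := 2) hβ (by norm_num [one_le_div])
    (by norm_num) (by rw [← NNReal.coe_le_coe]; norm_num) (by rw [← NNReal.coe_le_coe]; norm_num) m
  rw [PMF.toOuterMeasure_map_apply]
  calc _ ≤ _ := PMF.toOuterMeasure_mono _ (fun ys hys => ?_)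
    _ ≤ _ := htail
    _ ≤ 1 * (voteError m : ℝ≥0∞) := by
      gcongr
      · exact toOuterMeasure_le_one _ _
      · rfl
    _ = voteError m := one_mul _
  obtain ⟨hv, hs⟩ := hys
  have hlen := length_of_mem_support_iid p m ys hs
  have hcount : ys.length = ys.count y + ys.countP fun a => decide (a ≠ y) := by
    rw [List.length_eq_countP_add_countP (fun a => a == y), List.count]
    congr 2
    funext a
    simp
  have hlt : ¬ 3 * ys.length ≤ 5 * ys.count y := fun h => hv (vote_eq_some (by omega) h)
  exact ⟨by omega, by omega⟩

/-- The vote can hardly produce two different results, whatever the distribution of the samples: all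
results but the most likely one have probability at most `1 / 2`. -/
theorem exists_one_sub_voteError_le {α : Type} [DecidableEq α] [Fintype α] [Nonempty α] (p : PMF α)
    (m : ℕ) : ∃ y, 1 - (voteError m : ℝ) ≤
      (((iid p m).map vote).toOuterMeasure {some y, none}).toReal := by
  obtain ⟨y₀, hy₀⟩ := Finite.exists_max (fun y => p y)
  refine ⟨y₀, one_sub_le_toReal_toOuterMeasure _ _ _ ?_⟩
  have hhalf : ∀ y, y ≠ y₀ → p.toOuterMeasure {a | a = y} ≤ ((1 / 2 : ℝ≥0) : ℝ≥0∞) := by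
    intro y hy
    have h₁ := (ENNReal.sum_le_tsum (f := p) {y, y₀}).trans_eq p.tsum_coe
    rw [Finset.sum_pair hy] at h₁
    have h₂ : p y + p y ≤ 1 := (add_le_add_right (hy₀ y) _).trans h₁
    rw [Set.ofPred_eq_eq_singleton, PMF.toOuterMeasure_apply_singleton]
    rw [← two_mul, mul_comm] at h₂
    simpa using (ENNReal.le_div_iff_mul_le (by simp) (by simp)).2 h₂
  -- Here `d = b ^ 5 - 1`, and `b` is so close to `1` that `(1 + d / 2) / b ^ 3` is below `ρ`.
  have htail : ∀ y ∈ Finset.univ.erase y₀, _ := fun y hy =>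
    toOuterMeasure_tail_le p (fun a => a = y) (b := 11 / 10) (d := 61051 / 100000) (C := 12)
      (ρ := 99 / 100) (j := 3) (hhalf y (Finset.ne_of_mem_erase hy))
      (by norm_num [one_le_div])
      (by norm_num) (by rw [← NNReal.coe_le_coe]; norm_num)
      (by rw [← NNReal.coe_le_coe]; norm_num) m
  rw [PMF.toOuterMeasure_map_apply]
  calc _ ≤ (iid p m).toOuterMeasure (⋃ y ∈ Finset.univ.erase y₀,
          {ys | 1 ≤ (ys.countP fun a => decide (a = y)) ∧
            3 * m ≤ 5 * ys.countP fun a => decide (a = y)}) :=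
        PMF.toOuterMeasure_mono _ (fun ys hys => ?_)
    _ ≤ _ := MeasureTheory.measure_biUnion_finset_le _ _
    _ ≤ _ := Finset.sum_le_sum htail
    _ = (∑ y ∈ Finset.univ.erase y₀, p y) * (voteError m : ℝ≥0∞) := by
      rw [Finset.sum_mul]
      simp only [Set.ofPred_eq_eq_singleton, PMF.toOuterMeasure_apply_singleton]
      rfl
    _ ≤ 1 * (voteError m : ℝ≥0∞) := by
      gcongr
      exact (ENNReal.sum_le_tsum _).trans_eq p.tsum_coe
    _ = voteError m := one_mul _
  obtain ⟨hv, hs⟩ := hys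
  have hlen := length_of_mem_support_iid p m ys hs
  cases hvote : vote ys with
  | none => exact absurd (by simp [hvote]) hv
  | some y =>
    have hne : y ≠ y₀ := fun h => hv (by simp [hvote, h])
    have hc := le_count_of_vote hvote
    rw [hlen, List.count] at hc
    exact Set.mem_biUnion (x := y) (by simp [hne]) hc

/-! ### Closeness of the two generators -/

theorem negligible_voteError : Negligible fun n => (voteError n : ℝ) := by
  intro k
  have h := (tendsto_pow_const_mul_const_pow_of_abs_lt_one k
    (r := 99 / 100) (by rw [abs_of_pos] <;> norm_num)).const_mul 12
  rw [mul_zero] at h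
  refine h.congr fun n => ?_
  simp only [voteError, NNReal.coe_mul, NNReal.coe_pow, NNReal.coe_div, NNReal.coe_ofNat]
  ring

/-- The output distribution of an algorithm applied to a sample from `p` differs little from the one
on a fixed input that `p` nearly always takes. -/
theorem abs_toReal_bind_sub_le {α β : Type*} (p : PMF α) (f : α → PMF β) (a : α) (b : β) :
    |((p.bind f) b).toReal - (f a b).toReal| ≤ 1 - (p a).toReal := by
  classical
  have hsum := p.tsum_coe
  rw [ENNReal.tsum_eq_add_tsum_ite a] at hsum
  set rest := ∑' x, if x = a then 0 else p x
  have hbind : (p.bind f) b = p a * f a b + ∑' x, if x = a then 0 else p x * f x b := by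
    rw [PMF.bind_apply, ENNReal.tsum_eq_add_tsum_ite a]
  have hle : (∑' x, if x = a then 0 else p x * f x b) ≤ rest := by
    refine ENNReal.tsum_le_tsum fun x => ?_
    split_ifs
    · exact le_rfl
    · exact mul_le_of_le_one_right' ((f x).coe_le_one b)
  have hrest : rest ≠ ∞ :=
    ne_top_of_le_ne_top ENNReal.one_ne_top (hsum ▸ le_add_self)
  have h₁ := congrArg ENNReal.toReal hsum
  rw [ENNReal.toReal_add (p.apply_ne_top a) hrest, ENNReal.toReal_one] at h₁
  have h₂ := congrArg ENNReal.toReal hbind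
  rw [ENNReal.toReal_add (ENNReal.mul_ne_top (p.apply_ne_top a) ((f a).apply_ne_top b))
    (ne_top_of_le_ne_top hrest hle), ENNReal.toReal_mul] at h₂
  have h₃ := ENNReal.toReal_mono hrest hle
  have h₄ : (f a b).toReal ≤ 1 := by
    simpa using ENNReal.toReal_mono ENNReal.one_ne_top ((f a).coe_le_one b)
  have h₅ : 0 ≤ (f a b).toReal := ENNReal.toReal_nonneg
  have h₆ : 0 ≤ (∑' x, if x = a then 0 else p x * f x b).toReal := ENNReal.toReal_nonneg
  have h₇ : 0 ≤ (p a).toReal := ENNReal.toReal_nonneg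
  rw [h₂, abs_le]
  constructor <;> nlinarith

theorem keyProb_eq_sum {n : ℕ} (K : Set (Bits n)) :
    keyProb K = ∑ k, (PMF.uniformOfFintype (Bits n) k).toReal * K.indicator (fun _ => 1) k := by
  rw [keyProb, PMF.toOuterMeasure_apply, tsum_fintype, ENNReal.toReal_sum]
  · refine Finset.sum_congr rfl fun k _ => ?_
    by_cases hk : k ∈ K <;> simp [hk]
  · intro k _
    exact ne_top_of_le_ne_top ((PMF.uniformOfFintype (Bits n)).apply_ne_top k)
      (Set.indicator_le_self _ _ _)

theorem sum_toReal_eq_one {α : Type*} [Fintype α] (p : PMF α) : ∑ a, (p a).toReal = 1 := by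
  rw [← ENNReal.toReal_sum fun a _ => p.apply_ne_top a, ← tsum_fintype (L := .unconditional α),
    p.tsum_coe, ENNReal.toReal_one]

theorem toReal_bind_apply {α β : Type*} [Fintype α] (p : PMF α) (f : α → PMF β) (b : β) :
    ((p.bind f) b).toReal = ∑ a, (p a).toReal * (f a b).toReal := by
  rw [PMF.bind_apply, tsum_fintype, ENNReal.toReal_sum]
  · simp only [ENNReal.toReal_mul]
  · exact fun a _ => ENNReal.mul_ne_top (p.apply_ne_top a) ((f a).apply_ne_top b)

theorem toReal_apply_le_one {α : Type*} (p : PMF α) (a : α) : (p a).toReal ≤ 1 := by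
  simpa using ENNReal.toReal_mono ENNReal.one_ne_top (p.coe_le_one a)

/-- If `G` and `G'` nearly always have the same output on the keys in `K`, then passing from one to
the other changes the success probability of an adversary by little. -/
theorem abs_realProb_sub_le {ℓ : ℕ → ℕ} {G : ∀ n, Bits n → PMF (Bits (ℓ n))}
    {G' : ∀ n, Bits n → PMF (Option (Bits (ℓ n)))} (A : Behaviour) {n : ℕ} {K : Set (Bits n)}
    {δ δ' : ℝ} (hδ : 0 ≤ δ + δ')
    (hK : ∀ k ∈ K, ∃ y, 1 - δ ≤ (G n k y).toReal ∧ 1 - δ' ≤ (G' n k (some y)).toReal) :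
    |realProb (fun _ => encBot) G' A n - realProb (fun _ => encBits) G A n| ≤
      1 - keyProb K + δ + δ' := by
  set u : Bits n → ℝ := fun k => (PMF.uniformOfFintype (Bits n) k).toReal
  have hu0 : ∀ k, 0 ≤ u k := fun k => ENNReal.toReal_nonneg
  have hu1 : ∑ k, u k = 1 := sum_toReal_eq_one _
  set f : Bits n → ℝ := fun k => (((G' n k).bind fun y => A n (encBot y)) [true]).toReal
  set g : Bits n → ℝ := fun k => (((G n k).bind fun y => A n (encBits y)) [true]).toReal
  have hfg : ∀ k, |f k - g k| ≤ 1 - K.indicator (fun _ => 1) k + (δ + δ') := by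
    intro k
    by_cases hk : k ∈ K
    · obtain ⟨y, h₁, h₂⟩ := hK k hk
      have hg := abs_toReal_bind_sub_le (G n k) (fun y => A n (encBits y)) y [true]
      have hf := abs_toReal_bind_sub_le (G' n k) (fun y => A n (encBot y)) (some y) [true]
      rw [Set.indicator_of_mem hk]
      calc |f k - g k| ≤ |f k - (A n (encBits y) [true]).toReal| +
              |(A n (encBits y) [true]).toReal - g k| := abs_sub_le _ _ _
        _ ≤ (1 - (G' n k (some y)).toReal) + (1 - (G n k y).toReal) :=
            add_le_add hf (by rw [abs_sub_comm]; exact hg)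
        _ ≤ 1 - 1 + (δ + δ') := by linarith
    · rw [Set.indicator_of_notMem hk, abs_le]
      have h₁ : 0 ≤ f k := ENNReal.toReal_nonneg
      have h₂ : 0 ≤ g k := ENNReal.toReal_nonneg
      have h₃ : f k ≤ 1 := toReal_apply_le_one _ _
      have h₄ : g k ≤ 1 := toReal_apply_le_one _ _
      constructor <;> linarith
  have hsub : realProb (fun _ => encBot) G' A n - realProb (fun _ => encBits) G A n =
      ∑ k, u k * (f k - g k) := by
    rw [realProb, realProb, toReal_bind_apply, toReal_bind_apply, ← Finset.sum_sub_distrib]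
    exact Finset.sum_congr rfl fun k _ => (mul_sub _ _ _).symm
  rw [hsub]
  calc |∑ k, u k * (f k - g k)| ≤ ∑ k, |u k * (f k - g k)| := Finset.abs_sum_le_sum_abs _ _
    _ ≤ ∑ k, u k * (1 - K.indicator (fun _ => 1) k + (δ + δ')) := by
      refine Finset.sum_le_sum fun k _ => ?_
      rw [abs_mul, abs_of_nonneg (hu0 k)]
      exact mul_le_mul_of_nonneg_left (hfg k) (hu0 k)
    _ = 1 - keyProb K + δ + δ' := by
      have hKu : keyProb K = ∑ k, u k * K.indicator (fun _ => 1) k := keyProb_eq_sum K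
      rw [hKu]
      simp only [mul_add, mul_sub, mul_one, Finset.sum_add_distrib, Finset.sum_sub_distrib,
        ← Finset.sum_mul, hu1]
      ring

end BotPRG

theorem mainTheorem6 (adv : BotPRG.AdversaryModel) (ε μ ν : ℕ → ℝ) (ℓ : ℕ → ℕ)
    (G : ∀ n, BotPRG.Bits n → PMF (BotPRG.Bits (ℓ n)))
    (hν_nonneg : ∀ n, 0 ≤ ν n) (hν_small : ∀ᶠ n in atTop, ν n ≤ 1 / 10)
    (hG : BotPRG.IsWeakPDPRG adv ε μ ν ℓ G) :
    ∃ η : ℕ → ℝ, BotPRG.Negligible η ∧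
      BotPRG.IsWeakBotPRG adv (fun n => ε n + μ n + ν n + η n) μ ℓ (BotPRG.Gvote G) := by
  classical
  -- For the finitely many `n` to which the tail bound does not apply, `η n = 1`
  -- makes the claims on `K n` trivial.
  set η : ℕ → ℝ := fun n => if ν n ≤ 1 / 10 ∧ 1 ≤ n then (BotPRG.voteError n : ℝ) else 1 with hη
  have hη_negl : BotPRG.Negligible η := by
    refine BotPRG.negligible_voteError.congr' ?_
    filter_upwards [hν_small, eventually_ge_atTop 1] with n h₁ h₂
    simp only [hη, if_pos (And.intro h₁ h₂)]
  have hη_nonneg : ∀ n, 0 ≤ η n := fun n => by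
    simp only [hη]
    split_ifs
    · exact (BotPRG.voteError n).coe_nonneg
    · exact zero_le_one
  obtain ⟨K, hKprob, hK⟩ := hG.pseudodeterminism
  have hvote : ∀ n, ∀ k ∈ K n, ∃ y, 1 - ν n ≤ (G n k y).toReal ∧
      1 - η n ≤ (BotPRG.Gvote G n k (some y)).toReal := by
    intro n k hk
    obtain ⟨y, hy⟩ := hK n k hk
    refine ⟨y, hy, ?_⟩
    by_cases hn : ν n ≤ 1 / 10 ∧ 1 ≤ n
    · simp only [hη, if_pos hn]
      exact BotPRG.one_sub_voteError_le_of_likely (G n k) y (by linarith [hn.1]) hn.2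
    · simp only [hη, if_neg hn, sub_self]
      exact ENNReal.toReal_nonneg
  refine ⟨η, hη_negl, hG.qpt.Gvote, ⟨K, hKprob, ⟨η, hη_negl, fun n k hk => ?_⟩,
    ⟨_, BotPRG.negligible_voteError, fun n k => ?_⟩⟩, hG.stretch, fun A hA => ?_⟩
  · obtain ⟨y, -, hy⟩ := hvote n k hk
    exact ⟨y, hy⟩
  · exact BotPRG.exists_one_sub_voteError_le (G n k) n
  · filter_upwards [hG.pseudorandom A hA] with n hn
    have h := BotPRG.abs_realProb_sub_le A (add_nonneg (hν_nonneg n) (hη_nonneg n)) (hvote n)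
    have h' := abs_sub_le (BotPRG.realProb (fun _ => BotPRG.encBot) (BotPRG.Gvote G) A n)
      (BotPRG.realProb (fun _ => BotPRG.encBits) G A n) (BotPRG.idealProb ℓ A n)
    linarith [hKprob n]
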